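/- Let $\|\cdot\|$ be any norm on $\mathbb{R}^K$ with dual norm $\|\cdot\|_*$. Write $L^m=\{u\in\mathbb{R}^m: u_m\ge (u_1^2+\dots+u_{m-1}^2)^{1/2}\}$, $m\ge 1$, for the second-order cones. A set $S\subseteq\mathbb{R}^n$ is *second-order cone representable* if there are finitely many matrices $A_j$ and vectors $b_j$ with $y\in S\iff \exists v:\ A_j(y,v)-b_j\in L^{m_j}$ for all $j$. *Decisions.* $x=(x_d,x_c)$ ranges over $\mathcal{X}=\overline{\mathcal{X}}\cap(\{0,1\}^{n_1}\times\mathbb{R}^{n_2})$, where $\overline{\mathcal{X}}$ is second-order cone representable. *Costs.* The support $\Xi\subseteq\mathbb{R}^K$ of the uncertainty is second-order cone representable, and the cost $c(x,y)$, for $x\in\mathcal{X}$, $y\in\Xi$, has one of the following two forms. (a) Single-stage: $\Xi\subseteq\mathbb{R}^K_{\ge 0}$ and $c(x,y)=\sum_{k=1}^K c_k(x)y_k$, where each $c_k$ is a real-valued function on a domain $D_k\supseteq\mathcal{X}$ whose epigraph $\{(x,u): x\in D_k,\ c_k(x)\le u\}$ is second-order cone representable. (b) Two-stage: $c(x,y)=\min\{q^{T}\gamma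 : \gamma\ge 0,\ T(y)x+W\gamma=h(y)\}$ with $T(y)=T_0+\sum_k y_kT_k$ and $h(y)=h_0+\sum_k y_kh_k$, where for all $x\in\mathcal{X}$, $y\in\Xi$ this linear program is feasible and has a finite optimal value. *Ambiguity set.* Let $y_1,\dots,y_N\in\Xi$ be data, let $\omega_n(z)\ge 0$ with $\sum_{n=1}^N\omega_n(z)=1$ be weights depending on the covariate $z$, let $\widehat{\mathbb{P}}(z)=\sum_n\omega_n(z)\delta_{y_n}$, and let $\epsilon_\theta(z)\ge 0$ be a radius with parameter $\theta$. Let $$\mathscr{U}_\theta(z)=\{\mathbb{P}: \mathbb{P}(\Xi)=1,\ d_W(\widehat{\mathbb{P}}(z),\mathbb{P})\le\epsilon_\theta(z)\},\qquad d_W(\mathbb{P},\mathbb{Q})=\inf_{\pi}\int\|y-y'\|\,d\pi(y,y'),$$ with $\mathbb{P}$ ranging over the Borel probability measures on $\mathbb{R}^K$ and $\pi$ over the couplings of $\mathbb{P}$ and $\mathbb{Q}$ (type-1 Wasserstein distance). The contextual Wasserstein DRO problem is $$\min_{x\in\mathcal{X}} f(x),\qquad f(x)=\sup_{\mathbb{P}\in\mathscr{U}_\theta(z)}\mathbb{E}_{y\sim\mathbb{P}}[c(x,y)].\tag{WDRO}$$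 A problem $\min_{x\in X}f(x)$ is a *linear cone program* if there are a linear objective $\ell(x,w)$ and finitely many constraints $A_j(x,w)-b_j\in\mathcal{C}_j$ in $x$ and finitely many real auxiliary variables $w$, with each $\mathcal{C}_j$ a second-order cone or the dual norm cone $\{(\gamma,t)\in\mathbb{R}^K\times\mathbb{R}:\|\gamma\|_*\le t\}$, such that $x\in X$ if and only if some $w$ makes $(x,w)$ feasible, and, for every $x\in X$, $f(x)$ is the minimum (attained) of $\ell(x,w)$ over all such $w$. It is a *mixed-integer linear cone program* if the same holds with the additional constraint $x_d\in\{0,1\}^{n_1}$ on $x$. Then, for all $\theta$ and $z$, $c(x,\cdot)$ is $\mathbb{P}$-integrable for all $x\in\mathcal{X}$ and $\mathbb{P}\in\mathscr{U}_\theta(z)$, and (i) (WDRO) is a mixed-integer linear cone program; (ii) for every fixed $x_d\in\{0,1\}^{n_1}$, the problem $\min\{f(x_d,x_c): x_c\in\mathbb{R}^{n_2},\ (x_d,x_c)\in\mathcal{X}\}$ is a linear cone program. -/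

import Mathlib

open MeasureTheory

/-- The second-order cone `L^{m+1} = {y ∈ ℝ^{m+1} : y_{m+1} ≥ √(y₁² + ⋯ + y_m²)}`.
For `m = 0` it is the half-line of non-negative reals. -/
def secondOrderCone (m : ℕ) : Set (Fin (m + 1) → ℝ) :=
  {y | Real.sqrt (∑ i : Fin m, y i.castSucc ^ 2) ≤ y (Fin.last m)}

/-- The cone `{(γ, t) : ‖γ‖_* ≤ t}` of the norm dual to `N`, that is,
`‖γ‖_* = sup {γᵀ y : N y ≤ 1}`. -/
def dualNormCone {K : ℕ} (N : Seminorm ℝ (Fin K → ℝ)) : Set (Fin (K + 1) → ℝ) :=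
  {p | ∀ y : Fin K → ℝ, N y ≤ 1 → (fun k : Fin K => p k.castSucc) ⬝ᵥ y ≤ p (Fin.last K)}

/-- `S` is second-order cone representable: it is the projection of a set described by finitely
many second-order cone inequalities `A_j (y, v) - b_j ∈ L^{m_j + 1}`. -/
def IsSOCRepresentable {ι : Type} [Fintype ι] (S : Set (ι → ℝ)) : Prop :=
  ∃ (p J : ℕ) (m : Fin J → ℕ) (A : ∀ j : Fin J, Matrix (Fin (m j + 1)) (ι ⊕ Fin p) ℝ)
    (b : ∀ j : Fin J, Fin (m j + 1) → ℝ),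
    ∀ y : ι → ℝ, y ∈ S ↔
      ∃ v : Fin p → ℝ, ∀ j : Fin J, (A j).mulVec (Sum.elim y v) - b j ∈ secondOrderCone (m j)

/-- The data of a linear cone program in the decision `x ∈ ℝ^ι` and auxiliary variables
`w ∈ ℝ^numAux`: minimize `objᵀ (x, w)` subject to `A_j (x, w) - b_j ∈ cone_j` for finitely many
`j`, where all cones belong to the family `𝒦`. -/
structure LinearConeProgram (𝒦 : ∀ m : ℕ, Set (Fin m → ℝ) → Prop) (ι : Type) [Fintype ι] where
  numAux : ℕ
  numCon : ℕ
  dim : Fin numCon → ℕ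
  cone : ∀ j : Fin numCon, Set (Fin (dim j) → ℝ)
  cone_mem : ∀ j : Fin numCon, 𝒦 (dim j) (cone j)
  A : ∀ j : Fin numCon, Matrix (Fin (dim j)) (ι ⊕ Fin numAux) ℝ
  b : ∀ j : Fin numCon, Fin (dim j) → ℝ
  obj : ι ⊕ Fin numAux → ℝ

namespace LinearConeProgram

/-- `(x, w)` satisfies all cone constraints. -/
def Feasible {𝒦 : ∀ m : ℕ, Set (Fin m → ℝ) → Prop} {ι : Type} [Fintype ι]
    (Q : LinearConeProgram 𝒦 ι) (x : ι → ℝ) (w : Fin Q.numAux → ℝ) : Prop :=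
  ∀ j : Fin Q.numCon, (Q.A j).mulVec (Sum.elim x w) - Q.b j ∈ Q.cone j

/-- The linear objective at `(x, w)`. -/
def value {𝒦 : ∀ m : ℕ, Set (Fin m → ℝ) → Prop} {ι : Type} [Fintype ι]
    (Q : LinearConeProgram 𝒦 ι) (x : ι → ℝ) (w : Fin Q.numAux → ℝ) : ℝ :=
  Q.obj ⬝ᵥ Sum.elim x w

end LinearConeProgram

/-- The problem `min_{x ∈ X} f x` is a linear cone program over the cones `𝒦`: for some linear
cone program in `x` and auxiliary variables `w`, the points of `X` are exactly those that extend
to a feasible `(x, w)`, and `f x` is the minimum of the linear objective over these extensions. -/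
def IsLinearConeProgram (𝒦 : ∀ m : ℕ, Set (Fin m → ℝ) → Prop) {ι : Type} [Fintype ι]
    (X : Set (ι → ℝ)) (f : (ι → ℝ) → EReal) : Prop :=
  ∃ Q : LinearConeProgram 𝒦 ι,
    (∀ x : ι → ℝ, x ∈ X ↔ ∃ w, Q.Feasible x w) ∧
    ∀ x ∈ X, IsLeast {t : EReal | ∃ w, Q.Feasible x w ∧ t = (Q.value x w : EReal)} (f x)

/-- The problem `min_{x ∈ X} f x`, with `x = (x_d, x_c)`, is a mixed-integer linear cone program
over the cones `𝒦`: the same as a linear cone program, but with the additional constraint that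
all coordinates of `x_d` lie in `{0, 1}`. -/
def IsMixedIntegerLinearConeProgram (𝒦 : ∀ m : ℕ, Set (Fin m → ℝ) → Prop) {n₁ n₂ : ℕ}
    (X : Set (Fin n₁ ⊕ Fin n₂ → ℝ)) (f : (Fin n₁ ⊕ Fin n₂ → ℝ) → EReal) : Prop :=
  ∃ Q : LinearConeProgram 𝒦 (Fin n₁ ⊕ Fin n₂),
    (∀ x : Fin n₁ ⊕ Fin n₂ → ℝ,
      x ∈ X ↔ (∀ i : Fin n₁, x (Sum.inl i) = 0 ∨ x (Sum.inl i) = 1) ∧ ∃ w, Q.Feasible x w) ∧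
    ∀ x ∈ X, IsLeast {t : EReal | ∃ w, Q.Feasible x w ∧ t = (Q.value x w : EReal)} (f x)

/-- The cones allowed in the reformulation of a Wasserstein problem whose transport cost is the
norm `N`: second-order cones and the cone of the dual norm. -/
inductive IsWassersteinCone {K : ℕ} (N : Seminorm ℝ (Fin K → ℝ)) :
    ∀ m : ℕ, Set (Fin m → ℝ) → Prop
  | secondOrder (m : ℕ) : IsWassersteinCone N (m + 1) (secondOrderCone m)
  | dualNorm : IsWassersteinCone N (K + 1) (dualNormCone N)

/-- The mixed-binary feasible region `X = Xbar ∩ ({0,1}^{n₁} × ℝ^{n₂})`. -/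
def mixedBinaryRegion {n₁ n₂ : ℕ} (Xbar : Set (Fin n₁ ⊕ Fin n₂ → ℝ)) :
    Set (Fin n₁ ⊕ Fin n₂ → ℝ) :=
  {x | x ∈ Xbar ∧ ∀ i : Fin n₁, x (Sum.inl i) = 0 ∨ x (Sum.inl i) = 1}

/-- Single-stage cost: `c(x, y) = ∑ k, c_k(x) y_k`, where each `c_k` is a real function on a
domain `D_k ⊇ X` with second-order cone representable epigraph, and the uncertainty is
non-negative. -/
def IsSingleStageCost {ι : Type} [Fintype ι] {K : ℕ} (X : Set (ι → ℝ)) (Ξ : Set (Fin K → ℝ))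
    (c : (ι → ℝ) → (Fin K → ℝ) → ℝ) : Prop :=
  (∀ y ∈ Ξ, ∀ k : Fin K, 0 ≤ y k) ∧
  ∃ (D : Fin K → Set (ι → ℝ)) (ck : Fin K → (ι → ℝ) → ℝ),
    (∀ k : Fin K, X ⊆ D k ∧
      IsSOCRepresentable {p : ι ⊕ Fin 1 → ℝ |
        (fun i => p (Sum.inl i)) ∈ D k ∧ ck k (fun i => p (Sum.inl i)) ≤ p (Sum.inr 0)}) ∧
    ∀ x ∈ X, ∀ y ∈ Ξ, c x y = ∑ k : Fin K, ck k x * y k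

/-- Two-stage cost with relatively complete recourse: for all `x ∈ X` and `y ∈ Ξ`, the linear
program `min {qᵀ γ : γ ≥ 0, T(y) x + W γ = h(y)}`, with `T` and `h` affine in `y`, is feasible and
has the optimal value `c(x, y)`. -/
def IsTwoStageCost {ι : Type} [Fintype ι] {K : ℕ} (X : Set (ι → ℝ)) (Ξ : Set (Fin K → ℝ))
    (c : (ι → ℝ) → (Fin K → ℝ) → ℝ) : Prop :=
  ∃ (r s : ℕ) (q : Fin s → ℝ) (W : Matrix (Fin r) (Fin s) ℝ)
    (T₀ : Matrix (Fin r) ι ℝ) (T : Fin K → Matrix (Fin r) ι ℝ)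
    (h₀ : Fin r → ℝ) (h : Fin K → Fin r → ℝ),
    ∀ x ∈ X, ∀ y ∈ Ξ,
      IsLeast {t : ℝ | ∃ γ : Fin s → ℝ, (∀ i, 0 ≤ γ i) ∧
        (T₀ + ∑ k : Fin K, y k • T k).mulVec x + W.mulVec γ = h₀ + ∑ k : Fin K, y k • h k ∧
        t = q ⬝ᵥ γ} (c x y)

/-- The (type-1) Wasserstein distance with transport cost `N (y - y')`: the infimum of the expected
transport cost over all couplings of `P` and `Q`. -/
noncomputable def wassersteinDist {K : ℕ} (N : Seminorm ℝ (Fin K → ℝ))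
    (P Q : Measure (Fin K → ℝ)) : ENNReal :=
  ⨅ (π : Measure ((Fin K → ℝ) × (Fin K → ℝ))) (_ : π.fst = P ∧ π.snd = Q),
    ∫⁻ p, ENNReal.ofReal (N (p.1 - p.2)) ∂π

/-- The weighted empirical distribution `∑ n, ω_n δ_{y_n}`. -/
noncomputable def weightedEmpirical {K M : ℕ} (ω : Fin M → ℝ) (y : Fin M → Fin K → ℝ) :
    Measure (Fin K → ℝ) :=
  ∑ n : Fin M, ENNReal.ofReal (ω n) • Measure.dirac (y n)

/-- The Wasserstein ambiguity set: probability distributions supported on `Ξ` at distance at most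
`ε` from the reference distribution. -/
def wassersteinAmbiguitySet {K : ℕ} (N : Seminorm ℝ (Fin K → ℝ)) (Ξ : Set (Fin K → ℝ))
    (Pref : Measure (Fin K → ℝ)) (ε : ℝ) : Set (Measure (Fin K → ℝ)) :=
  {P | IsProbabilityMeasure P ∧ P Ξ = 1 ∧ wassersteinDist N Pref P ≤ ENNReal.ofReal ε}

/-- The worst-case expectation `sup_{P ∈ 𝒰} E_P[c(x, y)]`, with values in the extended reals. -/
noncomputable def worstCaseExpectation {ι : Type} {K : ℕ} (𝒰 : Set (Measure (Fin K → ℝ)))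
    (c : (ι → ℝ) → (Fin K → ℝ) → ℝ) (x : ι → ℝ) : EReal :=
  ⨆ P ∈ 𝒰, ((∫ y, c x y ∂P : ℝ) : EReal)

/-!
The reference distribution has finitely many atoms, so the couplings of bounded transport cost form
a convex problem whose Lagrangian decouples over the atoms. Hence the worst-case expectation is the
minimum of `l * ε + ∑ n, ω n * t n` over `l ≥ 0` and `t` with `c x v - l * ‖v - y n‖ ≤ t n` for
all `v ∈ Ξ` and all atoms. At `ε = 0` there is no Slater point, and a Lipschitz constant of `c x`
serves as the multiplier `l`.

Both forms of the cost are maxima of finitely many affine functions of `y` (for the linear program,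
Fourier–Motzkin elimination makes its epigraph polyhedral), so `c x` may be replaced by `a ⬝ᵥ v`.
Convex separation turns `a ⬝ᵥ v - l * ‖v - u‖ ≤ s` on `Ξ` into `‖ρ‖_* ≤ l` and a bound on the
support function of `Ξ` at `a - ρ`, for an auxiliary `ρ`. The epigraph of the support function is
cone representable by conic duality, which is exact and attained without a Slater point once each
second-order cone with a relative interior point of the feasible set on its boundary is replaced by
its supporting half-space there.
-/

section Affine

variable {E F G : Type*} [AddCommGroup E] [Module ℝ E] [AddCommGroup F] [Module ℝ F]
  [AddCommGroup G] [Module ℝ G]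

/-- The map `φ` between real vector spaces is affine. Being unbundled, the predicate lets
`fun_prop` check that a constraint of a cone program is affine in all variables. -/
@[fun_prop]
def IsAffineFun (φ : E → F) : Prop :=
  ∃ A : E →ᵃ[ℝ] F, ⇑A = φ

namespace IsAffineFun

@[fun_prop]
theorem id : IsAffineFun fun x : E => x := ⟨AffineMap.id ℝ E, rfl⟩

@[fun_prop]
theorem const (c : F) : IsAffineFun fun _ : E => c := ⟨AffineMap.const ℝ E c, rfl⟩

@[fun_prop]
theorem comp {ψ : F → G} {φ : E → F} (hψ : IsAffineFun ψ) (hφ : IsAffineFun φ) :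
    IsAffineFun fun x => ψ (φ x) := by
  obtain ⟨A, rfl⟩ := hψ
  obtain ⟨B, rfl⟩ := hφ
  exact ⟨A.comp B, rfl⟩

@[fun_prop]
theorem linearMap (L : E →ₗ[ℝ] F) : IsAffineFun fun x => L x := ⟨L.toAffineMap, rfl⟩

@[fun_prop]
theorem linearEquiv (L : E ≃ₗ[ℝ] F) : IsAffineFun fun x => L x := linearMap L.toLinearMap

@[fun_prop]
theorem apply {I : Type*} {H : I → Type*} [∀ i, AddCommGroup (H i)] [∀ i, Module ℝ (H i)]
    (i : I) : IsAffineFun fun f : ∀ i, H i => f i :=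
  linearMap (LinearMap.proj (R := ℝ) (φ := H) i)

@[fun_prop]
theorem pi {I : Type*} {H : I → Type*} [∀ i, AddCommGroup (H i)] [∀ i, Module ℝ (H i)]
    {φ : E → ∀ i, H i} (h : ∀ i, IsAffineFun fun x => φ x i) : IsAffineFun fun x i => φ x i := by
  choose A hA using h
  exact ⟨AffineMap.pi A, by ext x i; exact congrFun (hA i) x⟩

@[fun_prop]
theorem fst {φ : E → F × G} (h : IsAffineFun φ) : IsAffineFun fun x => (φ x).1 :=
  (linearMap (LinearMap.fst ℝ F G)).comp h

@[fun_prop]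
theorem snd {φ : E → F × G} (h : IsAffineFun φ) : IsAffineFun fun x => (φ x).2 :=
  (linearMap (LinearMap.snd ℝ F G)).comp h

@[fun_prop]
theorem prodMk {φ : E → F} {ψ : E → G} (hφ : IsAffineFun φ) (hψ : IsAffineFun ψ) :
    IsAffineFun fun x => (φ x, ψ x) := by
  obtain ⟨A, rfl⟩ := hφ
  obtain ⟨B, rfl⟩ := hψ
  exact ⟨A.prod B, rfl⟩

@[fun_prop]
theorem add {φ ψ : E → F} (hφ : IsAffineFun φ) (hψ : IsAffineFun ψ) :
    IsAffineFun fun x => φ x + ψ x := by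
  obtain ⟨A, rfl⟩ := hφ
  obtain ⟨B, rfl⟩ := hψ
  exact ⟨A + B, rfl⟩

@[fun_prop]
theorem sub {φ ψ : E → F} (hφ : IsAffineFun φ) (hψ : IsAffineFun ψ) :
    IsAffineFun fun x => φ x - ψ x := by
  obtain ⟨A, rfl⟩ := hφ
  obtain ⟨B, rfl⟩ := hψ
  exact ⟨A - B, rfl⟩

@[fun_prop]
theorem sum {I : Type*} (s : Finset I) {φ : I → E → F} (h : ∀ i, IsAffineFun (φ i)) :
    IsAffineFun fun x => ∑ i ∈ s, φ i x := by
  classical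
  induction s using Finset.induction_on with
  | empty => simpa using const 0
  | insert i s hi ih => simpa only [Finset.sum_insert hi] using (h i).add ih

@[fun_prop]
theorem const_mul (c : ℝ) {φ : E → ℝ} (hφ : IsAffineFun φ) : IsAffineFun fun x => c * φ x :=
  (linearMap (LinearMap.mulLeft ℝ c)).comp hφ

@[fun_prop]
theorem mul_const {φ : E → ℝ} (hφ : IsAffineFun φ) (c : ℝ) : IsAffineFun fun x => φ x * c :=
  (linearMap (LinearMap.mulRight ℝ c)).comp hφ

@[fun_prop]
theorem const_dotProduct {I : Type*} [Fintype I] (c : I → ℝ) {φ : E → I → ℝ}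
    (hφ : IsAffineFun φ) : IsAffineFun fun x => c ⬝ᵥ φ x := by
  unfold dotProduct
  fun_prop

@[fun_prop]
theorem dotProduct_const {I : Type*} [Fintype I] {φ : E → I → ℝ} (hφ : IsAffineFun φ)
    (c : I → ℝ) : IsAffineFun fun x => φ x ⬝ᵥ c := by
  unfold dotProduct
  fun_prop

@[fun_prop]
theorem mulVec {I J : Type*} [Fintype I] (A : Matrix J I ℝ) {φ : E → I → ℝ}
    (hφ : IsAffineFun φ) : IsAffineFun fun x => A.mulVec (φ x) := by
  unfold Matrix.mulVec
  fun_prop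

@[fun_prop]
theorem sumElim {I J : Type*} {φ : E → I → ℝ} {ψ : E → J → ℝ} (hφ : IsAffineFun φ)
    (hψ : IsAffineFun ψ) : IsAffineFun fun x => Sum.elim (φ x) (ψ x) :=
  pi fun i => match i with
    | .inl i => (apply i).comp hφ
    | .inr j => (apply j).comp hψ

@[fun_prop]
theorem dual_apply {φ : E → Module.Dual ℝ F} (h : IsAffineFun φ) (y : F) :
    IsAffineFun fun x => φ x y :=
  (linearMap (Module.Dual.eval ℝ F y)).comp h

theorem exists_matrix {I J : Type*} [Fintype I] {φ : (I → ℝ) → J → ℝ} (hφ : IsAffineFun φ) :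
    ∃ (A : Matrix J I ℝ) (b : J → ℝ), ∀ x, φ x = A.mulVec x - b := by
  classical
  obtain ⟨f, rfl⟩ := hφ
  refine ⟨fun j i => f.linear (Pi.single i 1) j, -f 0, fun x => ?_⟩
  have hlin : f.linear x = f.linear.toMatrix'.mulVec x :=
    (LinearMap.toMatrix'_mulVec f.linear x).symm
  rw [congrFun f.decomp x, sub_neg_eq_add, Pi.add_apply, hlin]
  rfl

end IsAffineFun

end Affine

section ConeRepresentability

variable {𝒦 : ∀ m : ℕ, Set (Fin m → ℝ) → Prop} {E F : Type*} [AddCommGroup E] [Module ℝ E]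
  [AddCommGroup F] [Module ℝ F]

/-- `S` is the projection of a set cut out by finitely many constraints `φ j (x, v) ∈ C j`, with
`φ j` affine and `C j` a cone of the family `𝒦`. Compared with `IsSOCRepresentable`, the cones
are arbitrary and no coordinates are chosen on the ambient space. -/
def IsConeRepresentable (𝒦 : ∀ m : ℕ, Set (Fin m → ℝ) → Prop) (S : Set E) : Prop :=
  ∃ (p J : ℕ) (m : Fin J → ℕ) (C : ∀ j, Set (Fin (m j) → ℝ))
    (φ : ∀ j, E × (Fin p → ℝ) → Fin (m j) → ℝ),
    (∀ j, 𝒦 (m j) (C j)) ∧ (∀ j, IsAffineFun (φ j)) ∧ ∀ x, x ∈ S ↔ ∃ v, ∀ j, φ j (x, v) ∈ C j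

namespace IsConeRepresentable

theorem of_finite {V J : Type*} [AddCommGroup V] [Module ℝ V] [Module.Finite ℝ V] [Finite J]
    {S : Set E} {m : J → ℕ} {C : ∀ j, Set (Fin (m j) → ℝ)} {φ : ∀ j, E × V → Fin (m j) → ℝ}
    (hC : ∀ j, 𝒦 (m j) (C j)) (hφ : ∀ j, IsAffineFun (φ j))
    (h : ∀ x, x ∈ S ↔ ∃ v, ∀ j, φ j (x, v) ∈ C j) : IsConeRepresentable 𝒦 S := by
  obtain ⟨J', ⟨e⟩⟩ := Finite.exists_equiv_fin J
  let f : V ≃ₗ[ℝ] (Fin (Module.finrank ℝ V) → ℝ) := (Module.finBasis ℝ V).equivFun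
  refine ⟨_, J', fun j => m (e.symm j), fun j => C (e.symm j),
    fun j p => φ (e.symm j) (p.1, f.symm p.2), fun j => hC _, fun j => by fun_prop, fun x => ?_⟩
  rw [h, f.symm.surjective.exists]
  exact exists_congr fun v => e.symm.surjective.forall

theorem comap {S : Set F} (h : IsConeRepresentable 𝒦 S) {ψ : E → F} (hψ : IsAffineFun ψ) :
    IsConeRepresentable 𝒦 {x | ψ x ∈ S} := by
  obtain ⟨p, J, m, C, φ, hC, hφ, h⟩ := h
  exact ⟨p, J, m, C, fun j x => φ j (ψ x.1, x.2), hC, fun j => by fun_prop, fun x => h _⟩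

theorem proj [Module.Finite ℝ F] {S : Set (E × F)} (h : IsConeRepresentable 𝒦 S) :
    IsConeRepresentable 𝒦 {x | ∃ y, (x, y) ∈ S} := by
  obtain ⟨p, J, m, C, φ, hC, hφ, h⟩ := h
  refine of_finite (V := F × (Fin p → ℝ)) (φ := fun j x => φ j ((x.1, x.2.1), x.2.2)) hC
    (fun j => by fun_prop) fun x => ?_
  simp only [Set.mem_ofPred_eq, h, Prod.exists]

theorem forall_mem {I : Type*} [Finite I] {S : I → Set E}
    (h : ∀ i, IsConeRepresentable 𝒦 (S i)) : IsConeRepresentable 𝒦 {x | ∀ i, x ∈ S i} := by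
  have := Fintype.ofFinite I
  choose p J m C φ hC hφ h using h
  refine of_finite (V := ∀ i, Fin (p i) → ℝ) (J := Σ i, Fin (J i))
    (φ := fun j x => φ j.1 j.2 (x.1, x.2 j.1)) (fun j => hC _ _) (fun j => by fun_prop)
    fun x => ?_
  simp only [Set.mem_ofPred_eq, h, Sigma.forall]
  exact Classical.skolem

theorem and {P Q : E → Prop} (hP : IsConeRepresentable 𝒦 {x | P x})
    (hQ : IsConeRepresentable 𝒦 {x | Q x}) : IsConeRepresentable 𝒦 {x | P x ∧ Q x} := by
  have := forall_mem (S := fun b : Bool => if b then {x | P x} else {x | Q x})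
    (fun b => by cases b <;> simpa)
  convert this using 2
  simp [and_comm]

theorem of_cone {m : ℕ} {C : Set (Fin m → ℝ)} (hC : 𝒦 m C) : IsConeRepresentable 𝒦 C :=
  of_finite (V := Fin 0 → ℝ) (J := Unit) (φ := fun _ x => x.1) (fun _ => hC)
    (fun _ => by fun_prop) (by simp)

section SecondOrder

variable (hSOC : ∀ m, 𝒦 (m + 1) (secondOrderCone m))
include hSOC

theorem nonneg {φ : E → ℝ} (hφ : IsAffineFun φ) : IsConeRepresentable 𝒦 {x | 0 ≤ φ x} := by
  have := (of_cone (hSOC 0)).comap (ψ := fun x (_ : Fin 1) => φ x) (by fun_prop)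
  simpa [secondOrderCone] using this

theorem le {φ ψ : E → ℝ} (hφ : IsAffineFun φ) (hψ : IsAffineFun ψ) :
    IsConeRepresentable 𝒦 {x | φ x ≤ ψ x} := by
  simpa only [sub_nonneg] using nonneg hSOC (hψ.sub hφ)

theorem eq [Module.Finite ℝ F] {φ ψ : E → F} (hφ : IsAffineFun φ) (hψ : IsAffineFun ψ) :
    IsConeRepresentable 𝒦 {x | φ x = ψ x} := by
  let e := (Module.finBasis ℝ F).equivFun
  have hle : ∀ {φ ψ : E → F}, IsAffineFun φ → IsAffineFun ψ → ∀ i,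
      IsConeRepresentable 𝒦 {x | e (φ x) i ≤ e (ψ x) i} :=
    fun hφ hψ i => le hSOC (by fun_prop) (by fun_prop)
  have hcoord := forall_mem fun i => (hle hφ hψ i).and (hle hψ hφ i)
  simpa only [Set.mem_ofPred_eq, ← le_antisymm_iff, ← funext_iff, e.injective.eq_iff] using hcoord

theorem of_isSOCRepresentable {ι : Type} [Fintype ι] {S : Set (ι → ℝ)}
    (h : IsSOCRepresentable S) : IsConeRepresentable 𝒦 S := by
  obtain ⟨p, J, m, A, b, h⟩ := h
  exact ⟨p, J, fun j => m j + 1, fun j => secondOrderCone (m j),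
    fun j x => (A j).mulVec (Sum.elim x.1 x.2) - b j, fun j => hSOC _, fun j => by fun_prop, h⟩

end SecondOrder

variable {ι : Type} [Fintype ι] {G : Set ((ι → ℝ) × ℝ)}

theorem exists_linearConeProgram (hG : IsConeRepresentable 𝒦 G) :
    ∃ Q : LinearConeProgram 𝒦 ι, ∀ x τ, (x, τ) ∈ G ↔ ∃ w, Q.Feasible x w ∧ Q.value x w = τ := by
  classical
  obtain ⟨p, J, m, C, φ, hC, hφ, h⟩ := hG
  have hφ' : ∀ j, IsAffineFun fun u : ι ⊕ Fin (p + 1) → ℝ => φ j (((fun i => u (Sum.inl i)),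
      u (Sum.inr 0)), fun i => u (Sum.inr i.succ)) := fun j => by fun_prop
  choose A b hAb using fun j => (hφ' j).exists_matrix
  refine ⟨⟨p + 1, J, m, C, hC, A, b, Pi.single (Sum.inr 0) 1⟩, fun x τ => ?_⟩
  rw [h]
  simp only [LinearConeProgram.Feasible, LinearConeProgram.value, ← hAb, single_dotProduct,
    Sum.elim_inr, Sum.elim_inl, one_mul]
  constructor
  · rintro ⟨v, hv⟩
    exact ⟨Fin.cons τ v, by simpa using hv, by simp⟩
  · rintro ⟨w, hw, rfl⟩
    exact ⟨_, hw⟩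

theorem exists_linearConeProgram_isLeast (hG : IsConeRepresentable 𝒦 G) :
    ∃ Q : LinearConeProgram 𝒦 ι, (∀ x, (∃ w, Q.Feasible x w) ↔ ∃ τ, (x, τ) ∈ G) ∧
      ∀ x (τ : ℝ), IsLeast {τ | (x, τ) ∈ G} τ →
        IsLeast {t : EReal | ∃ w, Q.Feasible x w ∧ t = (Q.value x w : EReal)} τ := by
  obtain ⟨Q, hQ⟩ := hG.exists_linearConeProgram
  refine ⟨Q, fun x => by simp [hQ], fun x τ ⟨hτ, hleast⟩ => ⟨?_, ?_⟩⟩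
  · obtain ⟨w, hw, rfl⟩ := (hQ x τ).1 hτ
    exact ⟨w, hw, rfl⟩
  · rintro _ ⟨w, hw, rfl⟩
    exact EReal.coe_le_coe_iff.2 (hleast ((hQ x _).2 ⟨w, hw, rfl⟩))

theorem isLinearConeProgram (hG : IsConeRepresentable 𝒦 G) {X : Set (ι → ℝ)}
    {f : (ι → ℝ) → EReal} (hX : ∀ x τ, (x, τ) ∈ G → x ∈ X)
    (hf : ∀ x ∈ X, ∃ τ : ℝ, f x = τ ∧ IsLeast {τ | (x, τ) ∈ G} τ) :
    IsLinearConeProgram 𝒦 X f := by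
  obtain ⟨Q, hfeas, hleast⟩ := hG.exists_linearConeProgram_isLeast
  refine ⟨Q, fun x => ?_, fun x hx => ?_⟩
  · rw [hfeas]
    exact ⟨fun hx => (hf x hx).imp fun _ h => h.2.1, fun ⟨τ, hτ⟩ => hX x τ hτ⟩
  · obtain ⟨τ, hfτ, hτ⟩ := hf x hx
    exact hfτ ▸ hleast x τ hτ

theorem isMixedIntegerLinearConeProgram {n₁ n₂ : ℕ} {G : Set ((Fin n₁ ⊕ Fin n₂ → ℝ) × ℝ)}
    (hG : IsConeRepresentable 𝒦 G) {X : Set (Fin n₁ ⊕ Fin n₂ → ℝ)}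
    {f : (Fin n₁ ⊕ Fin n₂ → ℝ) → EReal} (hX : ∀ x τ, (x, τ) ∈ G → x ∈ X)
    (hf : ∀ x ∈ mixedBinaryRegion X, ∃ τ : ℝ, f x = τ ∧ IsLeast {τ | (x, τ) ∈ G} τ) :
    IsMixedIntegerLinearConeProgram 𝒦 (mixedBinaryRegion X) f := by
  obtain ⟨Q, hfeas, hleast⟩ := hG.exists_linearConeProgram_isLeast
  refine ⟨Q, fun x => ?_, fun x hx => ?_⟩
  · rw [hfeas]
    exact ⟨fun hx => ⟨hx.2, (hf x hx).imp fun _ h => h.2.1⟩, fun ⟨hb, τ, hτ⟩ => ⟨hX x τ hτ, hb⟩⟩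
  · obtain ⟨τ, hfτ, hτ⟩ := hf x hx
    exact hfτ ▸ hleast x τ hτ

end IsConeRepresentable

end ConeRepresentability

section ConicDuality

theorem nonneg_of_forall_pos_add_mul {a b : ℝ} (h : ∀ s > 0, 0 ≤ a + s * b) : 0 ≤ a := by
  have hlim : Filter.Tendsto (fun s => a + s * b) (nhdsWithin 0 (Set.Ioi 0)) (nhds a) :=
    ((by fun_prop : Continuous fun s => a + s * b).tendsto' 0 a (by simp)).mono_left
      nhdsWithin_le_nhds
  exact ge_of_tendsto hlim (eventually_mem_nhdsWithin.mono h)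

variable {V Y : Type*} [AddCommGroup V] [Module ℝ V] [AddCommGroup Y] [Module ℝ Y]

theorem exists_nonneg_dual_comp_eq {O : PointedCone ℝ Y} {M : V →ₗ[ℝ] Y} {g : V →ₗ[ℝ] ℝ}
    (habs : ∀ y, ∃ v, M v + y ∈ O) (hg : ∀ v, M v ∈ O → 0 ≤ g v) :
    ∃ z : Module.Dual ℝ Y, (∀ y ∈ O, 0 ≤ z y) ∧ z ∘ₗ M = g := by
  have hker : ∀ v, M v = 0 → g v = 0 := fun v hv => by
    refine le_antisymm ?_ (hg v (hv ▸ O.zero_mem))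
    simpa using hg (-v) (by simp [hv])
  obtain ⟨z₀, rfl⟩ : g ∈ LinearMap.range M.dualMap := by
    rwa [LinearMap.range_dualMap_eq_dualAnnihilator_ker, Submodule.mem_dualAnnihilator]
  have nonneg : ∀ x : M.range, (x : Y) ∈ O → 0 ≤ z₀ x := by
    rintro ⟨_, v, rfl⟩ hv
    exact hg v hv
  obtain ⟨z, hz, hzO⟩ := riesz_extension O (z₀.toPMap M.range) nonneg
    fun y => (habs y).elim fun v hv => ⟨⟨M v, v, rfl⟩, hv⟩
  exact ⟨z, hzO, LinearMap.ext fun v => hz ⟨M v, v, rfl⟩⟩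

theorem exists_dual_multiplier {O : PointedCone ℝ Y} {L : V →ₗ[ℝ] Y} {ℓ : V →ₗ[ℝ] ℝ} {r : Y}
    {α : ℝ} (hr : r ∈ O) (habs : ∀ y, ∃ t : ℝ, y + t • r ∈ O)
    (h : ∀ v, r + L v ∈ O → 0 ≤ α + ℓ v) :
    ∃ z : Module.Dual ℝ Y, (∀ y ∈ O, 0 ≤ z y) ∧ z r ≤ α ∧ z ∘ₗ L = ℓ := by
  let M : ℝ × V →ₗ[ℝ] Y × ℝ := (LinearMap.coprod (.toSpanSingleton ℝ Y r) L).prod (.fst ℝ ℝ V)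
  let g : ℝ × V →ₗ[ℝ] ℝ := LinearMap.coprod (.toSpanSingleton ℝ ℝ α) ℓ
  have mem_prod : ∀ y τ, (y, τ) ∈ O.prod (PointedCone.positive ℝ ℝ) ↔ y ∈ O ∧ 0 ≤ τ :=
    fun _ _ => Iff.rfl
  have hdense : ∀ p, ∃ q, M q + p ∈ O.prod (PointedCone.positive ℝ ℝ) := fun ⟨y, τ⟩ => by
    obtain ⟨t, ht⟩ := habs y
    refine ⟨(max t (-τ), 0), (mem_prod _ _).2 ⟨?_, neg_le_iff_add_nonneg.1 (le_max_right t _)⟩⟩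
    convert O.add_mem ht (O.smul_mem (sub_nonneg.2 (le_max_left t (-τ))) hr) using 1
    change max t (-τ) • r + L 0 + y = _
    rw [map_zero]
    module
  have hnonneg : ∀ q, M q ∈ O.prod (PointedCone.positive ℝ ℝ) → 0 ≤ g q := by
    rintro ⟨τ, v⟩ ⟨hmem, hτ : 0 ≤ τ⟩
    replace hmem : τ • r + L v ∈ O := hmem
    refine nonneg_of_forall_pos_add_mul (b := α) fun s hs => ?_
    have hτs : 0 < τ + s := by positivity
    have := mul_nonneg hτs.le (h ((τ + s)⁻¹ • v) ?_)
    · rw [map_smul, smul_eq_mul, mul_add, mul_inv_cancel_left₀ hτs.ne'] at this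
      simpa [g, add_mul, add_right_comm] using this
    · convert O.smul_mem (inv_nonneg.2 hτs.le) (O.add_mem hmem (O.smul_mem hs.le hr)) using 1
      rw [map_smul]
      match_scalars <;> field_simp
  obtain ⟨z, hz, hzM⟩ := exists_nonneg_dual_comp_eq hdense hnonneg
  refine ⟨z ∘ₗ .inl ℝ Y ℝ, fun y hy => hz _ ((mem_prod y 0).2 ⟨hy, le_rfl⟩), ?_,
    LinearMap.ext fun v => ?_⟩
  · have hα : z (r, 1) = α := by simpa [M, g] using LinearMap.congr_fun hzM (1, 0)
    have hsplit : (r, (1 : ℝ)) = (r, 0) + (0, 1) := by simp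
    rw [hsplit, map_add] at hα
    exact hα ▸ le_add_of_nonneg_right (hz _ ((mem_prod 0 1).2 ⟨O.zero_mem, zero_le_one⟩))
  · simpa [M, g] using LinearMap.congr_fun hzM (0, v)

end ConicDuality

section FacialReduction

variable {W Y : Type*} [NormedAddCommGroup W] [NormedSpace ℝ W] [AddCommGroup Y] [Module ℝ Y]

/-- The cone `O` and the subspace `T` regularize the cone `Q` at `r ∈ Q`: the point `r` is interior
to the larger cone `O`, which agrees with `Q` on `T`, and `T` contains the minimal face of `Q`
through `r`. Convex duality for constraints `f w ∈ Q` may fail in the absence of a Slater point,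
whereas for `f w ∈ O` on the subspace `T` it is exact. -/
structure IsFacialReduction (Q O : PointedCone ℝ Y) (T : Submodule ℝ Y) (r : Y) : Prop where
  mem : r ∈ Q
  le : Q ≤ O
  absorbing : ∀ y, ∃ t : ℝ, y + t • r ∈ O
  mem_of_mem_of_mem : ∀ y ∈ O, y ∈ T → y ∈ Q
  mem_of_extension : ∀ p ∈ Q, ∀ t > (0 : ℝ), r + t • (r - p) ∈ Q → p ∈ T

theorem exists_extension_mem_of_mem_intrinsicInterior {s : Set W} {x q : W}
    (hx : x ∈ intrinsicInterior ℝ s) (hq : q ∈ s) : ∃ t > (0 : ℝ), x + t • (x - q) ∈ s := by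
  obtain ⟨x', hx', rfl⟩ := hx
  let g : ℝ → affineSpan ℝ s := fun t =>
    ⟨AffineMap.lineMap (x' : W) q (-t),
      AffineMap.lineMap_mem _ x'.2 (subset_affineSpan ℝ s hq)⟩
  have hg : Continuous g := by
    refine Continuous.subtype_mk ?_ _
    simp only [AffineMap.lineMap_apply]
    fun_prop
  have hev : ∀ᶠ t in nhds (0 : ℝ), g t ∈ interior ((↑) ⁻¹' s) :=
    hg.continuousAt.eventually_mem (isOpen_interior.mem_nhds (by simpa [g] using hx'))
  obtain ⟨t, hts, ht⟩ := ((hev.filter_mono nhdsWithin_le_nhds).and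
    (self_mem_nhdsWithin (s := Set.Ioi (0 : ℝ)))).exists
  refine ⟨t, ht, ?_⟩
  have hmem : g t ∈ (↑) ⁻¹' s := interior_subset hts
  convert Set.mem_preimage.1 hmem using 1
  simp only [g, AffineMap.lineMap_apply, vsub_eq_sub, vadd_eq_add]
  module

namespace IsFacialReduction

theorem pi {J : Type*} [Finite J] {H : J → Type*} [∀ j, AddCommGroup (H j)]
    [∀ j, Module ℝ (H j)] {Q O : ∀ j, PointedCone ℝ (H j)} {T : ∀ j, Submodule ℝ (H j)}
    {r : ∀ j, H j} (h : ∀ j, IsFacialReduction (Q j) (O j) (T j) (r j)) :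
    IsFacialReduction (Submodule.pi Set.univ Q) (Submodule.pi Set.univ O)
      (Submodule.pi Set.univ T) r where
  mem j _ := (h j).mem
  le _ hy j hj := (h j).le (hy j hj)
  absorbing y := by
    choose t ht using fun j => (h j).absorbing (y j)
    obtain ⟨B, hB⟩ := (Set.finite_range t).bddAbove
    refine ⟨B, fun j _ => ?_⟩
    have hsplit : (y + B • r) j = (y j + t j • r j) + (B - t j) • r j := by
      rw [Pi.add_apply, Pi.smul_apply]
      module
    rw [hsplit]
    exact (O j).add_mem (ht j) ((O j).smul_mem (sub_nonneg.2 (hB ⟨j, rfl⟩)) ((h j).le (h j).mem))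
  mem_of_mem_of_mem y hO hT j hj := (h j).mem_of_mem_of_mem _ (hO j hj) (hT j hj)
  mem_of_extension p hp t ht hpt j hj := (h j).mem_of_extension _ (hp j hj) t ht (hpt j hj)

variable {Q O : PointedCone ℝ Y} {T : Submodule ℝ Y}

theorem base_mem {r : Y} (h : IsFacialReduction Q O T r) : r ∈ T :=
  h.mem_of_extension r h.mem 1 one_pos (by simpa using h.mem)

theorem forall_le_iff {f : W →ᵃ[ℝ] Y} {w₀ : W} (h : IsFacialReduction Q O T (f w₀))
    (hw₀ : w₀ ∈ intrinsicInterior ℝ (f ⁻¹' Q)) (φ : Module.Dual ℝ W) (s : ℝ) :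
    (∀ w, f w ∈ Q → φ w ≤ s) ↔ ∃ z : Module.Dual ℝ Y, (∀ y ∈ O, 0 ≤ z y) ∧
      z (f w₀) + φ w₀ ≤ s ∧ (T.comap f.linear).subtype.dualMap (f.linear.dualMap z + φ) = 0 := by
  have hf : ∀ v, f w₀ + f.linear v = f (w₀ + v) := fun v => by
    rw [add_comm, add_comm w₀]
    exact (f.map_vadd w₀ v).symm
  constructor
  · intro hφ
    obtain ⟨z, hz, hr, hL⟩ := exists_dual_multiplier (h.le h.mem) h.absorbing
      (L := f.linear ∘ₗ (T.comap f.linear).subtype) (ℓ := -φ ∘ₗ (T.comap f.linear).subtype)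
      (α := s - φ w₀) fun v hv => by
        have := hφ _ (hf v ▸ h.mem_of_mem_of_mem _ hv (T.add_mem h.base_mem v.2))
        rw [map_add] at this
        simp only [LinearMap.comp_apply, LinearMap.neg_apply, Submodule.subtype_apply]
        linarith
    refine ⟨z, hz, by linarith, LinearMap.ext fun v => ?_⟩
    have := LinearMap.congr_fun hL v
    simp only [LinearMap.comp_apply, LinearMap.neg_apply, Submodule.subtype_apply] at this
    simp [this]
  · rintro ⟨z, hz, hs, hL⟩ w hw
    obtain ⟨t, ht, hext⟩ := exists_extension_mem_of_mem_intrinsicInterior hw₀ hw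
    have hsub : f w = f w₀ + f.linear (w - w₀) := by rw [hf, add_sub_cancel]
    have hT : f w ∈ T := h.mem_of_extension _ hw t ht <| by
      replace hext : f (w₀ + t • (w₀ - w)) ∈ Q := hext
      convert hext using 1
      rw [← hf, hsub, ← neg_sub w w₀, map_smul, map_neg]
      module
    have hV : w - w₀ ∈ T.comap f.linear := by
      rw [Submodule.mem_comap]
      exact eq_sub_of_add_eq' hsub.symm ▸ T.sub_mem hT h.base_mem
    have hzero : z (f.linear (w - w₀)) + φ (w - w₀) = 0 := LinearMap.congr_fun hL ⟨_, hV⟩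
    have hzw := hz _ (h.le hw)
    rw [hsub, map_add] at hzw
    rw [map_sub φ] at hzero
    linarith

theorem isConeRepresentable_forall_le {𝒦 : ∀ m : ℕ, Set (Fin m → ℝ) → Prop}
    (hSOC : ∀ m, 𝒦 (m + 1) (secondOrderCone m)) [Module.Finite ℝ W] [Module.Finite ℝ Y]
    {f : W →ᵃ[ℝ] Y} {w₀ : W} (h : IsFacialReduction Q O T (f w₀))
    (hw₀ : w₀ ∈ intrinsicInterior ℝ (f ⁻¹' Q))
    (hO : IsConeRepresentable 𝒦 {z : Module.Dual ℝ Y | ∀ y ∈ O, 0 ≤ z y}) :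
    IsConeRepresentable 𝒦 {p : Module.Dual ℝ W × ℝ | ∀ w, f w ∈ Q → p.1 w ≤ p.2} := by
  simp only [h.forall_le_iff hw₀]
  have hmul := (hO.comap (ψ := Prod.snd (α := Module.Dual ℝ W × ℝ)) (by fun_prop)).and
    ((IsConeRepresentable.le hSOC (φ := fun p => p.2 (f w₀) + p.1.1 w₀) (ψ := fun p => p.1.2)
      (by fun_prop) (by fun_prop)).and
    (.eq hSOC (φ := fun p => (T.comap f.linear).subtype.dualMap (f.linear.dualMap p.2 + p.1.1))
      (ψ := fun _ => 0) (by fun_prop) (by fun_prop)))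
  exact hmul.proj

end IsFacialReduction

end FacialReduction

section NormCone

/-- The cone `{(x, t) | ‖x‖ ≤ t}`, of which `secondOrderCone m` is the coordinate form for
`E = EuclideanSpace ℝ (Fin m)`. -/
def normCone (E : Type*) [SeminormedAddCommGroup E] [NormedSpace ℝ E] : PointedCone ℝ (E × ℝ) :=
  .ofConeComb {p | ‖p.1‖ ≤ p.2} ⟨0, by simp⟩ fun x hx y hy a ha b hb => calc
    ‖a • x.1 + b • y.1‖ ≤ a * ‖x.1‖ + b * ‖y.1‖ := by
      simpa [norm_smul, abs_of_nonneg, ha, hb] using norm_add_le (a • x.1) (b • y.1)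
    _ ≤ a * x.2 + b * y.2 :=
      add_le_add (mul_le_mul_of_nonneg_left hx ha) (mul_le_mul_of_nonneg_left hy hb)

theorem mem_normCone {E : Type*} [SeminormedAddCommGroup E] [NormedSpace ℝ E] {p : E × ℝ} :
    p ∈ normCone E ↔ ‖p.1‖ ≤ p.2 :=
  Iff.rfl

theorem mem_secondOrderCone_iff {m : ℕ} {y : Fin (m + 1) → ℝ} :
    y ∈ secondOrderCone m ↔
      (WithLp.toLp 2 fun i : Fin m => y i.castSucc, y (Fin.last m)) ∈
        normCone (EuclideanSpace ℝ (Fin m)) := by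
  simp [secondOrderCone, mem_normCone, EuclideanSpace.norm_eq]

theorem forall_mem_normCone_inner_nonneg_iff {E : Type*} [NormedAddCommGroup E]
    [InnerProductSpace ℝ E] {c : E} {γ : ℝ} :
    (∀ y ∈ normCone E, 0 ≤ inner ℝ c y.1 + γ * y.2) ↔ ‖c‖ ≤ γ := by
  constructor
  · intro h
    have hγ : 0 ≤ γ := by simpa using h (0, 1) (mem_normCone.2 (by simp))
    have hc : ‖c‖ ^ 2 ≤ γ * ‖c‖ := by
      simpa using h (-c, ‖c‖) (mem_normCone.2 (by simp))
    rcases eq_or_lt_of_le (norm_nonneg c) with h0 | hpos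
    · exact h0 ▸ hγ
    · exact le_of_mul_le_mul_right (by rwa [← sq]) hpos
  · intro hc y hy
    have hmul : ‖c‖ * ‖y.1‖ ≤ γ * y.2 :=
      mul_le_mul hc hy (norm_nonneg _) ((norm_nonneg c).trans hc)
    linarith [neg_le_of_abs_le (abs_real_inner_le_norm c y.1)]

theorem forall_nonneg_imp_nonneg_iff {E : Type*} [AddCommGroup E] [Module ℝ E]
    {g z : Module.Dual ℝ E} : (∀ y, 0 ≤ g y → 0 ≤ z y) ↔ ∃ k : ℝ, 0 ≤ k ∧ z = k • g := by
  constructor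
  · intro h
    have hker : ∀ y, g y = 0 → z y = 0 := fun y hy =>
      le_antisymm (by simpa using h (-y) (by simp [hy])) (h y hy.ge)
    by_cases hg : ∃ y, g y = 1
    · obtain ⟨y₀, hy₀⟩ := hg
      refine ⟨z y₀, h y₀ (hy₀ ▸ zero_le_one), LinearMap.ext fun y => ?_⟩
      have := hker (y - g y • y₀) (by simp [hy₀])
      rw [map_sub, map_smul, smul_eq_mul, sub_eq_zero] at this
      rw [this, LinearMap.smul_apply, smul_eq_mul, mul_comm]
    · have hg0 : g = 0 := by
        by_contra hne
        exact hg (LinearMap.surjective hne 1)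
      exact ⟨0, le_rfl, LinearMap.ext fun y => by simp [hker y (by simp [hg0])]⟩
  · rintro ⟨k, hk, rfl⟩ y hy
    exact mul_nonneg hk hy

variable {E : Type*} [NormedAddCommGroup E] [NormedSpace ℝ E] {r : E × ℝ}

theorem isFacialReduction_normCone_of_norm_lt (hr : ‖r.1‖ < r.2) :
    IsFacialReduction (normCone E) (normCone E) ⊤ r where
  mem := hr.le
  le := le_rfl
  absorbing y := by
    have hpos := sub_pos.2 hr
    set t := |‖y.1‖ - y.2| / (r.2 - ‖r.1‖)
    have htr : t * (r.2 - ‖r.1‖) = |‖y.1‖ - y.2| := div_mul_cancel₀ _ hpos.ne'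
    refine ⟨t, mem_normCone.2 ?_⟩
    calc ‖y.1 + t • r.1‖ ≤ ‖y.1‖ + t * ‖r.1‖ := by
          simpa [norm_smul, abs_of_nonneg (by positivity : 0 ≤ t)] using norm_add_le y.1 (t • r.1)
      _ ≤ y.2 + t * r.2 := by linarith [le_abs_self (‖y.1‖ - y.2)]
  mem_of_mem_of_mem _ hy _ := hy
  mem_of_extension _ _ _ _ _ := trivial

theorem mem_span_singleton_of_extension_mem_normCone [StrictConvexSpace ℝ E] (hr : ‖r.1‖ = r.2)
    {p : E × ℝ} (hp : p ∈ normCone E) {t : ℝ} (ht : 0 < t) (h : r + t • (r - p) ∈ normCone E) :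
    p ∈ Submodule.span ℝ {r} := by
  set q := r + t • (r - p) with hq
  have hsum : q + t • p = (1 + t) • r := by rw [hq]; module
  have hsum₁ : q.1 + t • p.1 = (1 + t) • r.1 := congrArg Prod.fst hsum
  have hsum₂ : q.2 + t * p.2 = (1 + t) * r.2 := congrArg Prod.snd hsum
  have hnorm : ‖q.1 + t • p.1‖ = q.2 + t * p.2 := by
    rw [hsum₁, hsum₂, norm_smul, Real.norm_of_nonneg (by positivity), hr]
  have htp : ‖t • p.1‖ = t * ‖p.1‖ := by rw [norm_smul, Real.norm_of_nonneg ht.le]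
  have hp' : t * ‖p.1‖ ≤ t * p.2 := mul_le_mul_of_nonneg_left hp ht.le
  have hq' : ‖q.1‖ ≤ q.2 := h
  have htri := norm_add_le q.1 (t • p.1)
  have hray : SameRay ℝ q.1 (t • p.1) := sameRay_iff_norm_add.2 (by linarith)
  obtain ⟨_, b, _, hb, _, _, hp₁⟩ := hray.exists_eq_smul_add
  rw [hsum₁, smul_smul] at hp₁
  have hp₂ : t * p.2 = b * (1 + t) * r.2 := by
    rw [← hr, ← Real.norm_of_nonneg (by positivity : 0 ≤ b * (1 + t)), ← norm_smul, ← hp₁]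
    linarith
  exact (Submodule.smul_mem_iff _ ht.ne').1
    (Submodule.mem_span_singleton.2 ⟨b * (1 + t), (Prod.ext hp₁ hp₂).symm⟩)

theorem isFacialReduction_normCone_of_norm_eq [StrictConvexSpace ℝ E] (hr : ‖r.1‖ = r.2) :
    IsFacialReduction (normCone E)
      ((PointedCone.positive ℝ ℝ).comap (r.2 • LinearMap.snd ℝ E ℝ)) (Submodule.span ℝ {r}) r where
  mem := hr.le
  le y hy := mul_nonneg (hr ▸ norm_nonneg _) ((norm_nonneg _).trans hy)
  absorbing y := by
    rcases (hr ▸ norm_nonneg _ : 0 ≤ r.2).eq_or_lt with h0 | hpos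
    · exact ⟨0, by simp [← h0]⟩
    · refine ⟨-y.2 / r.2, ?_⟩
      simp [hpos.ne']
  mem_of_mem_of_mem y hy hyr := by
    obtain ⟨k, rfl⟩ := Submodule.mem_span_singleton.1 hyr
    replace hy : 0 ≤ r.2 * (k * r.2) := hy
    rcases (hr ▸ norm_nonneg _ : 0 ≤ r.2).eq_or_lt with h0 | hpos
    · have hr0 : r = 0 := Prod.ext (norm_eq_zero.1 (hr.trans h0.symm)) h0.symm
      simp [hr0]
    · have hk : 0 ≤ k := by
        rwa [mul_nonneg_iff_of_pos_left hpos, mul_nonneg_iff_of_pos_right hpos] at hy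
      exact (normCone E).smul_mem hk hr.le
  mem_of_extension p hp t ht h := mem_span_singleton_of_extension_mem_normCone hr hp ht h

variable {𝒦 : ∀ m : ℕ, Set (Fin m → ℝ) → Prop}

theorem isConeRepresentable_dual_pi {J : Type*} [Finite J] {H : J → Type*}
    [∀ j, AddCommGroup (H j)] [∀ j, Module ℝ (H j)] {O : ∀ j, PointedCone ℝ (H j)}
    (hO : ∀ j, IsConeRepresentable 𝒦 {z : Module.Dual ℝ (H j) | ∀ y ∈ O j, 0 ≤ z y}) :
    IsConeRepresentable 𝒦
      {z : Module.Dual ℝ (∀ j, H j) | ∀ y ∈ Submodule.pi Set.univ O, 0 ≤ z y} := by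
  classical
  have := Fintype.ofFinite J
  have hcomp := IsConeRepresentable.forall_mem fun j => (hO j).comap
    (ψ := (LinearMap.single ℝ H j).dualMap) (by fun_prop)
  convert hcomp using 3 with z
  constructor
  · intro hz j y hy
    refine hz _ fun i _ => ?_
    rcases eq_or_ne i j with rfl | hij
    · simpa using hy
    · simp [hij]
  · intro hz y hy
    rw [← Finset.univ_sum_single y, map_sum]
    exact Finset.sum_nonneg fun j _ => hz j _ (hy j trivial)

variable (hSOC : ∀ m, 𝒦 (m + 1) (secondOrderCone m))
include hSOC

theorem isConeRepresentable_dual_halfspace [Module.Finite ℝ E] (g : Module.Dual ℝ E) :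
    IsConeRepresentable 𝒦
      {z : Module.Dual ℝ E | ∀ y ∈ (PointedCone.positive ℝ ℝ).comap g, 0 ≤ z y} := by
  change IsConeRepresentable 𝒦 {z : Module.Dual ℝ E | ∀ y, 0 ≤ g y → 0 ≤ z y}
  simp only [forall_nonneg_imp_nonneg_iff]
  have hmul := (IsConeRepresentable.nonneg hSOC (φ := fun p : Module.Dual ℝ E × ℝ => p.2)
    (by fun_prop)).and (.eq hSOC (φ := fun p => p.1)
      (ψ := fun p => LinearMap.toSpanSingleton ℝ _ g p.2) (by fun_prop) (by fun_prop))
  exact hmul.proj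

theorem isConeRepresentable_dual_normCone (m : ℕ) :
    IsConeRepresentable 𝒦 {z : Module.Dual ℝ (EuclideanSpace ℝ (Fin m) × ℝ) |
      ∀ y ∈ normCone (EuclideanSpace ℝ (Fin m)), 0 ≤ z y} := by
  have hsoc := (IsConeRepresentable.of_cone (hSOC m)).comap
    (ψ := fun (z : Module.Dual ℝ (EuclideanSpace ℝ (Fin m) × ℝ)) i =>
      z (Fin.lastCases (0, 1) (fun i => (EuclideanSpace.single i 1, 0)) i)) (by fun_prop)
  convert hsoc using 3 with z
  rw [mem_secondOrderCone_iff, mem_normCone, ← forall_mem_normCone_inner_nonneg_iff]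
  refine forall₂_congr fun y _ => ?_
  have hsum : y = ∑ i, y.1 i • (EuclideanSpace.single i 1, 0) + y.2 • (0, 1) := by
    refine Prod.ext ?_ (by simp [Prod.snd_sum])
    ext i
    simp [Prod.fst_sum, Pi.single_apply]
  have hz : z y = _ := (congrArg z hsum).trans (map_add _ _ _)
  rw [hz]
  simp only [map_sum, map_smul]
  simp [PiLp.inner_apply, mul_comm]

theorem exists_isFacialReduction_normCone {m : ℕ} {r : EuclideanSpace ℝ (Fin m) × ℝ}
    (hr : r ∈ normCone (EuclideanSpace ℝ (Fin m))) :
    ∃ (O : PointedCone ℝ (EuclideanSpace ℝ (Fin m) × ℝ))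
      (T : Submodule ℝ (EuclideanSpace ℝ (Fin m) × ℝ)),
      IsFacialReduction (normCone (EuclideanSpace ℝ (Fin m))) O T r ∧
        IsConeRepresentable 𝒦 {z : Module.Dual ℝ _ | ∀ y ∈ O, 0 ≤ z y} := by
  rcases (mem_normCone.1 hr).lt_or_eq with hlt | heq
  · exact ⟨_, _, isFacialReduction_normCone_of_norm_lt hlt,
      isConeRepresentable_dual_normCone hSOC m⟩
  · exact ⟨_, _, isFacialReduction_normCone_of_norm_eq heq,
      isConeRepresentable_dual_halfspace hSOC _⟩

end NormCone

namespace IsSOCRepresentable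

variable {ι : Type} [Fintype ι] {S : Set (ι → ℝ)}

theorem exists_affineMap_normCone (h : IsSOCRepresentable S) :
    ∃ (p J : ℕ) (m : Fin J → ℕ)
      (f : (ι → ℝ) × (Fin p → ℝ) →ᵃ[ℝ] ∀ j, EuclideanSpace ℝ (Fin (m j)) × ℝ),
      S = Prod.fst '' (f ⁻¹' Submodule.pi Set.univ
        fun j => normCone (EuclideanSpace ℝ (Fin (m j)))) := by
  obtain ⟨p, J, m, A, b, h⟩ := h
  let g (w : (ι → ℝ) × (Fin p → ℝ)) (j : Fin J) : Fin (m j + 1) → ℝ :=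
    (A j).mulVec (Sum.elim w.1 w.2) - b j
  have hg : IsAffineFun fun w j => ((WithLp.linearEquiv 2 ℝ (Fin (m j) → ℝ)).symm
      fun i => g w j i.castSucc, g w j (Fin.last (m j))) := by
    fun_prop
  obtain ⟨f, hf⟩ := hg
  refine ⟨p, J, m, f, Set.ext fun y => ?_⟩
  rw [h]
  simp [mem_secondOrderCone_iff, hf, g]

theorem convex (h : IsSOCRepresentable S) : Convex ℝ S := by
  obtain ⟨p, J, m, f, rfl⟩ := h.exists_affineMap_normCone
  exact ((PointedCone.convex _).affine_preimage f).linear_image (.fst ℝ _ _)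

theorem measurableSet (h : IsSOCRepresentable S) : MeasurableSet S := by
  obtain ⟨p, J, m, f, rfl⟩ := h.exists_affineMap_normCone
  have hclosed : IsClosed (f ⁻¹' Submodule.pi Set.univ
      fun j => normCone (EuclideanSpace ℝ (Fin (m j)))) :=
    (isClosed_set_pi fun j _ => isClosed_le (by fun_prop) continuous_snd).preimage
      f.continuous_of_finiteDimensional
  have hσ := (isSigmaCompact_univ.of_isClosed_subset hclosed (Set.subset_univ _)).image
    continuous_fst
  obtain ⟨C, hC, hCS⟩ := hσ
  exact hCS ▸ MeasurableSet.iUnion fun n => (hC n).measurableSet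

theorem isConeRepresentable_forall_dotProduct_le {𝒦 : ∀ m : ℕ, Set (Fin m → ℝ) → Prop}
    (hSOC : ∀ m, 𝒦 (m + 1) (secondOrderCone m)) (h : IsSOCRepresentable S) (hne : S.Nonempty) :
    IsConeRepresentable 𝒦 {p : (ι → ℝ) × ℝ | ∀ y ∈ S, p.1 ⬝ᵥ y ≤ p.2} := by
  classical
  obtain ⟨p, J, m, f, rfl⟩ := h.exists_affineMap_normCone
  obtain ⟨w₀, hw₀⟩ := hne.of_image.intrinsicInterior
    ((PointedCone.convex _).affine_preimage f)
  choose O T hO hdual using fun j =>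
    exists_isFacialReduction_normCone hSOC (intrinsicInterior_subset hw₀ j trivial)
  have hpolar := ((IsFacialReduction.pi hO).isConeRepresentable_forall_le hSOC hw₀
    (isConeRepresentable_dual_pi hdual)).comap
      (ψ := fun p : (ι → ℝ) × ℝ => ((LinearMap.fst ℝ _ _).dualMap (dotProductEquiv ℝ ι p.1), p.2))
      (by fun_prop)
  simpa [Set.forall_mem_image] using hpolar

end IsSOCRepresentable

section Seminorms

open scoped Pointwise

variable {E : Type*} [AddCommGroup E] [Module ℝ E]

theorem exists_dual_le_mul_of_definite [Module.Finite ℝ E] {N : Seminorm ℝ E}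
    (hN : ∀ v, N v = 0 → v = 0) (φ : Module.Dual ℝ E) : ∃ L : ℝ, ∀ v, φ v ≤ L * N v := by
  let : NormedAddCommGroup E := AddGroupNorm.toNormedAddCommGroup
    { N.toAddGroupSeminorm with eq_zero_of_map_eq_zero' := hN }
  let : NormedSpace ℝ E := ⟨fun r v => (map_smul_eq_mul N r v).le⟩
  exact ⟨‖φ.toContinuousLinearMap‖,
    fun v => (le_abs_self _).trans (φ.toContinuousLinearMap.le_opNorm v)⟩

theorem exists_dual_le_seminorm_add_sub {S : Set E} (hS : Convex ℝ S) (hne : S.Nonempty)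
    (a : E →ᵃ[ℝ] ℝ) (p : Seminorm ℝ E) (h : ∀ y ∈ S, a y ≤ p y) :
    ∃ ρ : Module.Dual ℝ E, ∀ y ∈ S, ∀ v, ρ v ≤ p (v + y) - a y := by
  obtain ⟨y₀, hy₀⟩ := hne
  set G := (AffineMap.id ℝ E).prod a '' S
  have hG : Convex ℝ G := hS.affine_image _
  let C : PointedCone ℝ (E × ℝ) :=
    { carrier := {q | ∃ r : ℝ, 0 ≤ r ∧ ∃ g ∈ r • G, p (q.1 + g.1) ≤ q.2 + g.2}
      zero_mem' := ⟨0, le_rfl, 0, by simp [Set.zero_smul_set (⟨_, y₀, hy₀, rfl⟩ : G.Nonempty)],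
        by simp⟩
      add_mem' := by
        rintro q q' ⟨r, hr, g, hg, h⟩ ⟨r', hr', g', hg', h'⟩
        refine ⟨r + r', add_nonneg hr hr', g + g', ?_, ?_⟩
        · exact hG.add_smul hr hr' ▸ Set.add_mem_add hg hg'
        · have := map_add_le_add p (q.1 + g.1) (q'.1 + g'.1)
          rw [add_add_add_comm] at this
          simp only [Prod.fst_add, Prod.snd_add]
          linarith
      smul_mem' := by
        rintro ⟨c, hc⟩ q ⟨r, hr, g, hg, h⟩
        refine ⟨c * r, mul_nonneg hc hr, c • g, mul_smul c r G ▸ Set.smul_mem_smul_set hg, ?_⟩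
        change p (c • q.1 + c • g.1) ≤ c * q.2 + c * g.2
        rw [← smul_add, ← mul_add, map_smul_eq_mul, Real.norm_of_nonneg hc]
        exact mul_le_mul_of_nonneg_left h hc }
  have mem_C : ∀ y ∈ S, ∀ v τ, p (v + y) ≤ τ + a y → (v, τ) ∈ C := fun y hy v τ hv =>
    ⟨1, zero_le_one, (y, a y), by simpa only [one_smul] using ⟨y, hy, rfl⟩, hv⟩
  have nonneg_of_mem_C : ∀ τ, LinearMap.inr ℝ E ℝ τ ∈ C → 0 ≤ LinearMap.id (R := ℝ) τ := by
    rintro τ ⟨r, hr, _, ⟨_, ⟨y, hy, rfl⟩, rfl⟩, hle : p (0 + r • y) ≤ τ + r * a y⟩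
    rw [zero_add, map_smul_eq_mul, Real.norm_of_nonneg hr] at hle
    exact (sub_nonneg.2 (mul_le_mul_of_nonneg_left (h y hy) hr)).trans (sub_le_iff_le_add.2 hle)
  obtain ⟨z, hzC, hz⟩ := exists_nonneg_dual_comp_eq (fun ⟨v, τ⟩ =>
    ⟨p (v + y₀) - a y₀ - τ, mem_C y₀ hy₀ _ _ (by simp)⟩) nonneg_of_mem_C
  have hz1 : ∀ τ, z (0, τ) = τ := LinearMap.congr_fun hz
  refine ⟨-z ∘ₗ .inl ℝ E ℝ, fun y hy v => ?_⟩
  have := hzC _ (mem_C y hy v (p (v + y) - a y) (by simp))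
  rw [← Prod.fst_add_snd (v, p (v + y) - a y), map_add, hz1] at this
  exact neg_le_iff_add_nonneg'.2 this

theorem exists_dual_between_of_convex {S : Set E} (hS : Convex ℝ S) (hne : S.Nonempty)
    (a : E →ᵃ[ℝ] ℝ) (p : Seminorm ℝ E) (h : ∀ y ∈ S, a y ≤ p y) :
    ∃ ρ : Module.Dual ℝ E, (∀ v, ρ v ≤ p v) ∧ ∀ y ∈ S, a y ≤ ρ y := by
  obtain ⟨ρ, hρ⟩ := exists_dual_le_seminorm_add_sub hS hne a p h
  obtain ⟨y₀, hy₀⟩ := hne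
  refine ⟨ρ, fun v => ?_, fun y hy => by simpa using hρ y hy (-y)⟩
  refine sub_nonneg.1 (nonneg_of_forall_pos_add_mul (b := p y₀ - a y₀) fun s hs => ?_)
  have hle : s⁻¹ * ρ v ≤ s⁻¹ * p v + (p y₀ - a y₀) := by
    have := hρ y₀ hy₀ (s⁻¹ • v)
    have := map_add_le_add p (s⁻¹ • v) y₀
    rw [map_smul_eq_mul, Real.norm_of_nonneg (inv_nonneg.2 hs.le)] at this
    rw [← smul_eq_mul, ← map_smul]
    linarith
  have := mul_le_mul_of_nonneg_left hle hs.le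
  rw [mul_add, mul_inv_cancel_left₀ hs.ne', mul_inv_cancel_left₀ hs.ne'] at this
  linarith

end Seminorms

section DualNorm

variable {K : ℕ} {N : Seminorm ℝ (Fin K → ℝ)} (hN : ∀ y : Fin K → ℝ, N y = 0 → y = 0)
include hN

theorem snoc_mem_dualNormCone_iff {ρ : Fin K → ℝ} {l : ℝ} :
    (Fin.snoc ρ l : Fin (K + 1) → ℝ) ∈ dualNormCone N ↔ 0 ≤ l ∧ ∀ v, ρ ⬝ᵥ v ≤ l * N v := by
  simp only [dualNormCone, Set.mem_ofPred_eq, Fin.snoc_castSucc, Fin.snoc_last]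
  constructor
  · intro h
    refine ⟨by simpa using h 0 (by simp), fun v => ?_⟩
    rcases (apply_nonneg N v).eq_or_lt with h0 | hpos
    · simp [hN v h0.symm]
    · have := h ((N v)⁻¹ • v) (by simp [map_smul_eq_mul, abs_of_pos hpos, hpos.ne'])
      rwa [dotProduct_smul, smul_eq_mul, inv_mul_le_iff₀ hpos, mul_comm] at this
  · rintro ⟨hl, h⟩ v hv
    exact (h v).trans (mul_le_of_le_one_right hl hv)

theorem forall_dotProduct_sub_le_iff {S : Set (Fin K → ℝ)} (hS : Convex ℝ S) (hne : S.Nonempty)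
    (g y₀ : Fin K → ℝ) (l s : ℝ) :
    (0 ≤ l ∧ ∀ y ∈ S, g ⬝ᵥ y - l * N (y - y₀) ≤ s) ↔
      ∃ ρ : Fin K → ℝ, (Fin.snoc ρ l : Fin (K + 1) → ℝ) ∈ dualNormCone N ∧
        ∀ y ∈ S, (g - ρ) ⬝ᵥ y ≤ s - ρ ⬝ᵥ y₀ := by
  simp only [snoc_mem_dualNormCone_iff hN]
  constructor
  · rintro ⟨hl, h⟩
    let a : (Fin K → ℝ) →ᵃ[ℝ] ℝ :=
      (dotProductEquiv ℝ (Fin K) g).toAffineMap + AffineMap.const ℝ _ (g ⬝ᵥ y₀ - s)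
    have ha : ∀ v, a v = g ⬝ᵥ v + (g ⬝ᵥ y₀ - s) := fun _ => rfl
    have hlN : ∀ v, (Real.toNNReal l • N) v = l * N v := by simp [NNReal.smul_def, hl]
    obtain ⟨φ, hφ, hφS⟩ := exists_dual_between_of_convex (hS.translate_preimage_right y₀)
      (hne.preimage (add_left_surjective y₀)) a (Real.toNNReal l • N) fun v hv => by
        have := h _ hv
        rw [add_sub_cancel_left, dotProduct_add] at this
        rw [hlN, ha]
        linarith
    obtain ⟨ρ, rfl⟩ := (dotProductEquiv ℝ (Fin K)).surjective φ
    refine ⟨ρ, ⟨hl, fun v => hlN v ▸ hφ v⟩, fun y hy => ?_⟩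
    have := hφS (y - y₀) (by simpa using hy)
    simp only [ha, dotProductEquiv_apply_apply, dotProduct_sub] at this
    rw [sub_dotProduct]
    linarith
  · rintro ⟨ρ, ⟨hl, hρ⟩, h⟩
    refine ⟨hl, fun y hy => ?_⟩
    have hle := hρ (y - y₀)
    have := h y hy
    rw [dotProduct_sub] at hle
    rw [sub_dotProduct] at this
    linarith

theorem isConeRepresentable_forall_dotProduct_sub_le {𝒦 : ∀ m : ℕ, Set (Fin m → ℝ) → Prop}
    (hSOC : ∀ m, 𝒦 (m + 1) (secondOrderCone m)) (hdual : 𝒦 (K + 1) (dualNormCone N))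
    {S : Set (Fin K → ℝ)} (hS : IsSOCRepresentable S) (hne : S.Nonempty) (y₀ : Fin K → ℝ) :
    IsConeRepresentable 𝒦 {p : (Fin K → ℝ) × ℝ × ℝ |
      0 ≤ p.2.1 ∧ ∀ y ∈ S, p.1 ⬝ᵥ y - p.2.1 * N (y - y₀) ≤ p.2.2} := by
  simp only [forall_dotProduct_sub_le_iff hN hS.convex hne]
  have hsnoc : IsAffineFun fun x : ((Fin K → ℝ) × ℝ × ℝ) × (Fin K → ℝ) =>
      (Fin.snoc x.2 x.1.2.1 : Fin (K + 1) → ℝ) := by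
    refine .pi fun i => i.lastCases ?_ fun i => ?_
    · simp only [Fin.snoc_last]
      fun_prop
    · simp only [Fin.snoc_castSucc]
      fun_prop
  have hmul := ((IsConeRepresentable.of_cone hdual).comap hsnoc).and
    ((hS.isConeRepresentable_forall_dotProduct_le hSOC hne).comap
      (ψ := fun x => (x.1.1 - x.2, x.1.2.2 - x.2 ⬝ᵥ y₀)) (by fun_prop))
  exact hmul.proj

end DualNorm

section Polyhedra

theorem exists_forall_le_and_forall_le {I J : Type*} [Finite I] [Finite J] {l : I → ℝ} {u : J → ℝ}
    (h : ∀ i j, l i ≤ u j) : ∃ t, (∀ i, l i ≤ t) ∧ ∀ j, t ≤ u j := by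
  cases isEmpty_or_nonempty I
  · obtain ⟨t, ht⟩ := (Set.finite_range u).bddBelow
    exact ⟨t, isEmptyElim, fun j => ht ⟨j, rfl⟩⟩
  · obtain ⟨i, hi⟩ := Finite.exists_max l
    exact ⟨l i, hi, h i⟩

theorem exists_forall_nonneg_add_mul_iff {I : Type*} [Finite I] (α β : I → ℝ) :
    (∃ t, ∀ i, 0 ≤ α i + t * β i) ↔ (∀ i, β i = 0 → 0 ≤ α i) ∧
      ∀ i, 0 < β i → ∀ j, β j < 0 → 0 ≤ β i * α j - β j * α i := by
  constructor
  · rintro ⟨t, ht⟩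
    refine ⟨fun i hi => by simpa [hi] using ht i, fun i hi j hj => ?_⟩
    linarith [mul_nonneg hi.le (ht j), mul_nonneg (neg_nonneg.2 hj.le) (ht i)]
  · rintro ⟨hzero, hpair⟩
    obtain ⟨t, hlower, hupper⟩ := exists_forall_le_and_forall_le
      (l := fun i : {i // 0 < β i} => -α i / β i) (u := fun j : {j // β j < 0} => α j / -β j)
      fun ⟨i, hi⟩ ⟨j, hj⟩ => by
        rw [div_le_div_iff₀ hi (neg_pos.2 hj)]
        linarith [hpair i hi j hj]
    refine ⟨t, fun i => ?_⟩
    rcases lt_trichotomy (β i) 0 with hi | hi | hi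
    · linarith [(le_div_iff₀ (neg_pos.2 hi)).1 (hupper ⟨i, hi⟩)]
    · simpa [hi] using hzero i hi
    · linarith [(div_le_iff₀ hi).1 (hlower ⟨i, hi⟩)]

variable {E F : Type*} [AddCommGroup E] [Module ℝ E] [AddCommGroup F] [Module ℝ F]

/-- `P` is a polyhedral cone: the solution set of finitely many homogeneous linear inequalities. -/
def IsPolyhedralCone (P : Set E) : Prop :=
  ∃ (I : Type) (_ : Finite I) (a : I → Module.Dual ℝ E), ∀ x, x ∈ P ↔ ∀ i, 0 ≤ a i x

theorem dual_apply_prodMk (a : Module.Dual ℝ (E × ℝ)) (x : E) (t : ℝ) :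
    a (x, t) = (a ∘ₗ .inl ℝ E ℝ) x + t * a (0, 1) := by
  rw [← smul_eq_mul, ← map_smul, LinearMap.comp_apply, ← map_add]
  simp

namespace IsPolyhedralCone

theorem nonneg (φ : Module.Dual ℝ E) : IsPolyhedralCone {x | 0 ≤ φ x} :=
  ⟨Unit, inferInstance, fun _ => φ, by simp⟩

theorem comap {P : Set F} (h : IsPolyhedralCone P) (f : E →ₗ[ℝ] F) :
    IsPolyhedralCone {x | f x ∈ P} :=
  let ⟨I, hI, a, h⟩ := h
  ⟨I, hI, fun i => a i ∘ₗ f, fun x => h (f x)⟩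

theorem forall_mem {I : Type} [Finite I] {P : I → Set E} (h : ∀ i, IsPolyhedralCone (P i)) :
    IsPolyhedralCone {x | ∀ i, x ∈ P i} := by
  choose J hJ a h using h
  exact ⟨Σ i, J i, inferInstance, fun k => a k.1 k.2, by simp [h, Sigma.forall]⟩

theorem and {p q : E → Prop} (hp : IsPolyhedralCone {x | p x}) (hq : IsPolyhedralCone {x | q x}) :
    IsPolyhedralCone {x | p x ∧ q x} := by
  have := forall_mem (P := fun b : Bool => if b then {x | p x} else {x | q x})
    (fun b => by cases b <;> simpa)
  simpa [and_comm] using this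

theorem eq {I : Type} [Finite I] (φ ψ : E →ₗ[ℝ] I → ℝ) : IsPolyhedralCone {x | φ x = ψ x} := by
  convert (forall_mem fun i => nonneg (.proj i ∘ₗ (φ - ψ))).and
    (forall_mem fun i => nonneg (.proj i ∘ₗ (ψ - φ))) with x
  simp [le_antisymm_iff, Pi.le_def, and_comm]

theorem exists_real {P : Set (E × ℝ)} (h : IsPolyhedralCone P) :
    IsPolyhedralCone {x | ∃ t, (x, t) ∈ P} := by
  obtain ⟨I, _, a, h⟩ := h
  let α : I → Module.Dual ℝ E := fun i => a i ∘ₗ .inl ℝ E ℝ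
  let β : I → ℝ := fun i => a i (0, 1)
  refine ⟨{i // β i = 0} ⊕ {i // 0 < β i} × {j // β j < 0}, inferInstance,
    Sum.elim (fun i => α i) fun p => β p.1 • α p.2 - β p.2 • α p.1, fun x => ?_⟩
  have hP : ∀ t, (x, t) ∈ P ↔ ∀ i, 0 ≤ α i x + t * β i := fun t => by
    rw [h]
    exact forall_congr' fun i => by rw [dual_apply_prodMk]
  simp only [Set.mem_ofPred_eq, hP]
  rw [exists_forall_nonneg_add_mul_iff]
  simp

theorem exists_pi {s : ℕ} {P : Set (E × (Fin s → ℝ))} (h : IsPolyhedralCone P) :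
    IsPolyhedralCone {x | ∃ γ, (x, γ) ∈ P} := by
  induction s with
  | zero =>
    convert h.comap (.inl ℝ E (Fin 0 → ℝ)) with x
    simp [Fin.exists_fin_zero_pi, Subsingleton.elim (0 : Fin 0 → ℝ) ![]]
  | succ s ih =>
    let f : (E × (Fin s → ℝ)) × ℝ →ₗ[ℝ] E × (Fin (s + 1) → ℝ) :=
      (.fst ℝ _ _ ∘ₗ .fst ℝ _ _).prod ((Fin.consLinearEquiv ℝ fun _ => ℝ).toLinearMap ∘ₗ
        .prod (.snd ℝ _ _) (.snd ℝ _ _ ∘ₗ .fst ℝ _ _))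
    convert ih (h.comap f).exists_real with x
    rw [Fin.exists_fin_succ_pi]
    exact exists_comm

theorem exists_isGreatest_range_dual_of_isLeast {P : Set (E × ℝ)} (h : IsPolyhedralCone P) :
    ∃ (I : Type) (_ : Finite I) (l : I → Module.Dual ℝ E), ∀ b v, IsLeast {t | (b, t) ∈ P} v →
      IsGreatest (Set.range fun i => l i b) v := by
  obtain ⟨I, _, a, h⟩ := h
  let α : I → Module.Dual ℝ E := fun i => a i ∘ₗ .inl ℝ E ℝ
  let β : I → ℝ := fun i => a i (0, 1)
  have hP : ∀ b t, (b, t) ∈ P ↔ ∀ i, 0 ≤ α i b + t * β i := fun b t => by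
    rw [h]
    exact forall_congr' fun i => by rw [dual_apply_prodMk]
  have hle : ∀ (i : {i // 0 < β i}) b t, -((β i)⁻¹ • α i) b ≤ t ↔ 0 ≤ α i b + t * β i :=
    fun ⟨i, hi⟩ b t => by
      rw [LinearMap.smul_apply, smul_eq_mul, ← mul_neg, inv_mul_le_iff₀ hi,
        neg_le_iff_add_nonneg', mul_comm]
  refine ⟨{i // 0 < β i}, inferInstance, fun i => -((β i)⁻¹ • α i), fun b v ⟨hv, hmin⟩ => ?_⟩
  have hupper := fun i => (hle i b v).2 ((hP b v).1 hv i)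
  refine ⟨?_, Set.forall_mem_range.2 hupper⟩
  by_contra! hne
  rw [Set.mem_range, not_exists] at hne
  obtain ⟨t, ht, htv⟩ := ((Filter.eventually_all.2 fun i => eventually_nhdsWithin_of_eventually_nhds
    (eventually_gt_nhds ((hupper i).lt_of_ne (hne i)))).and
    (self_mem_nhdsWithin : Set.Iio v ∈ nhdsWithin v (Set.Iio v))).exists
  refine (hmin ((hP b t).2 fun i => ?_)).not_gt htv
  by_cases hi : 0 < β i
  · exact (hle ⟨i, hi⟩ b t).1 (ht ⟨i, hi⟩).le
  · have := (hP b v).1 hv i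
    linarith [mul_le_mul_of_nonpos_right (Set.mem_Iio.1 htv).le (not_lt.1 hi)]

end IsPolyhedralCone

theorem exists_isGreatest_range_dual_of_linearProgram {r s : ℕ} (q : Fin s → ℝ)
    (W : Matrix (Fin r) (Fin s) ℝ) :
    ∃ (I : Type) (_ : Finite I) (l : I → Module.Dual ℝ (Fin r → ℝ)), ∀ b v,
      IsLeast {t | ∃ γ, (∀ i, 0 ≤ γ i) ∧ W.mulVec γ = b ∧ t = q ⬝ᵥ γ} v →
        IsGreatest (Set.range fun i => l i b) v := by
  let b : ((Fin r → ℝ) × ℝ) × (Fin s → ℝ) →ₗ[ℝ] Fin r → ℝ := .fst ℝ _ _ ∘ₗ .fst ℝ _ _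
  let t : ((Fin r → ℝ) × ℝ) × (Fin s → ℝ) →ₗ[ℝ] ℝ := .snd ℝ _ _ ∘ₗ .fst ℝ _ _
  let γ : ((Fin r → ℝ) × ℝ) × (Fin s → ℝ) →ₗ[ℝ] Fin s → ℝ := .snd ℝ _ _
  have hP : IsPolyhedralCone {p : (Fin r → ℝ) × ℝ |
      ∃ γ : Fin s → ℝ, (∀ i, 0 ≤ γ i) ∧ W.mulVec γ = p.1 ∧ 0 ≤ p.2 - q ⬝ᵥ γ} :=
    ((IsPolyhedralCone.forall_mem fun i => .nonneg (.proj i ∘ₗ γ)).and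
      ((IsPolyhedralCone.eq (W.mulVecLin ∘ₗ γ) b).and
        (.nonneg (t - dotProductEquiv ℝ _ q ∘ₗ γ)))).exists_pi
  obtain ⟨I, hI, l, hl⟩ := hP.exists_isGreatest_range_dual_of_isLeast
  refine ⟨I, hI, l, fun b v ⟨⟨γ, hγ, hb, hv⟩, hmin⟩ =>
    hl b v ⟨⟨γ, hγ, hb, sub_nonneg.2 hv.ge⟩, ?_⟩⟩
  rintro t ⟨γ, hγ, hb, ht⟩
  exact (hmin ⟨γ, hγ, hb, rfl⟩).trans (sub_nonneg.1 ht)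

end Polyhedra

section Costs

variable {𝒦 : ∀ m : ℕ, Set (Fin m → ℝ) → Prop} {ι : Type} [Fintype ι] {K : ℕ}
  {X : Set (ι → ℝ)} {Ξ : Set (Fin K → ℝ)} {c : (ι → ℝ) → (Fin K → ℝ) → ℝ}

/-- For every `x ∈ X` the cost `c x` is on `Ξ` a maximum of finitely many affine functions. Their
coefficients `d` need not be affine in `x`: they are constrained by `(x, d) ∈ R` for a representable
relation `R`, which may contain further `d`, as long as these majorize `c x`. -/
def IsMaxAffineCost (𝒦 : ∀ m : ℕ, Set (Fin m → ℝ) → Prop) (X : Set (ι → ℝ))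
    (Ξ : Set (Fin K → ℝ)) (c : (ι → ℝ) → (Fin K → ℝ) → ℝ) : Prop :=
  ∃ (I : Type) (_ : Finite I) (R : Set ((ι → ℝ) × (I → (Fin K → ℝ) × ℝ))),
    IsConeRepresentable 𝒦 R ∧
    (∀ x ∈ X, ∃ d, (x, d) ∈ R ∧ ∀ y ∈ Ξ,
      IsGreatest (Set.range fun i => (d i).1 ⬝ᵥ y + (d i).2) (c x y)) ∧
    ∀ x ∈ X, ∀ d, (x, d) ∈ R → ∀ y ∈ Ξ, ∃ i, c x y ≤ (d i).1 ⬝ᵥ y + (d i).2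

theorem IsSingleStageCost.isMaxAffineCost (hSOC : ∀ m, 𝒦 (m + 1) (secondOrderCone m))
    (h : IsSingleStageCost X Ξ c) : IsMaxAffineCost 𝒦 X Ξ c := by
  obtain ⟨hΞ, D, ck, hD, hc⟩ := h
  let R : Set ((ι → ℝ) × (Unit → (Fin K → ℝ) × ℝ)) :=
    {p | (∀ k, p.1 ∈ D k ∧ ck k p.1 ≤ (p.2 ()).1 k) ∧ (p.2 ()).2 = 0}
  have hR : IsConeRepresentable 𝒦 R := by
    refine (IsConeRepresentable.forall_mem fun k => ?_).and
      (.eq hSOC (φ := fun p : (ι → ℝ) × (Unit → (Fin K → ℝ) × ℝ) => (p.2 ()).2)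
        (by fun_prop) (.const 0))
    exact (IsConeRepresentable.of_isSOCRepresentable hSOC (hD k).2).comap
      (ψ := fun p : (ι → ℝ) × (Unit → (Fin K → ℝ) × ℝ) =>
        Sum.elim p.1 fun _ => (p.2 ()).1 k) (by fun_prop)
  refine ⟨Unit, inferInstance, R, hR, fun x hx => ⟨fun _ => (fun k => ck k x, 0), ?_, ?_⟩, ?_⟩
  · exact ⟨fun k => ⟨(hD k).1 hx, le_rfl⟩, rfl⟩
  · intro y hy
    simp [hc x hx y hy, dotProduct]
  · intro x hx d hd y hy
    rw [hc x hx y hy]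
    refine ⟨(), ?_⟩
    rw [hd.2, add_zero]
    exact Finset.sum_le_sum fun k _ => mul_le_mul_of_nonneg_right (hd.1 k).2 (hΞ y hy k)

theorem dual_twoStage_eq_dotProduct_add {r : ℕ} (l : Module.Dual ℝ (Fin r → ℝ))
    (T₀ : Matrix (Fin r) ι ℝ) (T : Fin K → Matrix (Fin r) ι ℝ) (h₀ : Fin r → ℝ)
    (h : Fin K → Fin r → ℝ) (x : ι → ℝ) (y : Fin K → ℝ) :
    l (h₀ + ∑ k, y k • h k - (T₀ + ∑ k, y k • T k).mulVec x) =
      (fun k => l (h k - (T k).mulVec x)) ⬝ᵥ y + l (h₀ - T₀.mulVec x) := by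
  simp only [Matrix.add_mulVec, Matrix.sum_mulVec, Matrix.smul_mulVec, map_sub, map_add, map_sum,
    map_smul, dotProduct, smul_eq_mul, sub_mul, Finset.sum_sub_distrib, mul_comm (y _)]
  abel

theorem IsTwoStageCost.isMaxAffineCost (hSOC : ∀ m, 𝒦 (m + 1) (secondOrderCone m))
    (h : IsTwoStageCost X Ξ c) : IsMaxAffineCost 𝒦 X Ξ c := by
  obtain ⟨r, s, q, W, T₀, T, h₀, h, hc⟩ := h
  obtain ⟨I, _, l, hl⟩ := exists_isGreatest_range_dual_of_linearProgram q W
  let d : (ι → ℝ) → I → (Fin K → ℝ) × ℝ :=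
    fun x i => (fun k => l i (h k - (T k).mulVec x), l i (h₀ - T₀.mulVec x))
  have hd : IsAffineFun d := by fun_prop
  have hmax : ∀ x ∈ X, ∀ y ∈ Ξ,
      IsGreatest (Set.range fun i => (d x i).1 ⬝ᵥ y + (d x i).2) (c x y) := by
    intro x hx y hy
    simp only [d, ← dual_twoStage_eq_dotProduct_add]
    refine hl _ _ ?_
    simpa only [eq_sub_iff_add_eq'] using hc x hx y hy
  refine ⟨I, inferInstance, {p | p.2 = d p.1}, .eq hSOC (by fun_prop) (hd.comp (by fun_prop)),
    fun x hx => ⟨d x, rfl, hmax x hx⟩, ?_⟩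
  intro x hx d' hd' y hy
  obtain ⟨i, hi⟩ := (hmax x hx y hy).1
  rw [show d' = d x from hd']
  exact ⟨i, hi.ge⟩

theorem exists_le_add_mul_of_isGreatest_range {N : Seminorm ℝ (Fin K → ℝ)}
    (hN : ∀ y, N y = 0 → y = 0) {I : Type*} [Finite I] (d : I → (Fin K → ℝ) × ℝ)
    {f : (Fin K → ℝ) → ℝ}
    (hf : ∀ y ∈ Ξ, IsGreatest (Set.range fun i => (d i).1 ⬝ᵥ y + (d i).2) (f y)) :
    ∃ L : ℝ, 0 ≤ L ∧ ∀ u ∈ Ξ, ∀ v ∈ Ξ, f u ≤ f v + L * N (u - v) := by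
  choose L hL using fun i => exists_dual_le_mul_of_definite hN (dotProductEquiv ℝ _ (d i).1)
  obtain ⟨B, hB⟩ := (Set.finite_range L).bddAbove
  refine ⟨max 0 B, le_max_left _ _, fun u hu v hv => ?_⟩
  obtain ⟨i, hi⟩ := (hf u hu).1
  have hLB : L i ≤ max 0 B := (hB ⟨i, rfl⟩).trans (le_max_right _ _)
  have := (hf v hv).2 ⟨i, rfl⟩
  have := hL i (u - v)
  simp only [dotProductEquiv_apply_apply, dotProduct_sub] at *
  linarith [mul_le_mul_of_nonneg_right hLB (apply_nonneg N (u - v))]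

end Costs

section Multipliers

theorem div_le_div_of_convex {D : Set (ℝ × ℝ)} (hD : Convex ℝ D) {ε F : ℝ}
    (hF : ∀ p ∈ D, p.1 ≤ ε → p.2 ≤ F) {p p' : ℝ × ℝ} (hp : p ∈ D) (hp' : p' ∈ D)
    (h : ε < p.1) (h' : p'.1 < ε) : (p.2 - F) / (p.1 - ε) ≤ (F - p'.2) / (ε - p'.1) := by
  have ha : 0 < p.1 - ε := sub_pos.2 h
  have hb : 0 < ε - p'.1 := sub_pos.2 h'
  have hab : 0 < p.1 - ε + (ε - p'.1) := add_pos ha hb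
  have hmem := convex_iff_div.1 hD hp' hp ha.le hb.le hab
  have hcross := hF _ hmem <| le_of_eq <| by
    simp only [Prod.fst_add, Prod.smul_fst, smul_eq_mul]
    field_simp
    ring
  simp only [Prod.snd_add, Prod.smul_snd, smul_eq_mul, div_mul_eq_mul_div, ← add_div] at hcross
  rw [div_le_iff₀ hab] at hcross
  rw [div_le_div_iff₀ ha hb]
  linarith

theorem exists_multiplier_of_convex {D : Set (ℝ × ℝ)} (hD : Convex ℝ D) {ε F : ℝ}
    (hslater : ∃ p ∈ D, p.1 < ε) (hF : ∀ p ∈ D, p.1 ≤ ε → p.2 ≤ F) :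
    ∃ l, 0 ≤ l ∧ ∀ p ∈ D, p.2 + l * (ε - p.1) ≤ F := by
  obtain ⟨l, hlower, hupper⟩ := exists_between_of_forall_le
    (s := insert 0 ((fun p : ℝ × ℝ => (p.2 - F) / (p.1 - ε)) '' {p ∈ D | ε < p.1}))
    (t := (fun p : ℝ × ℝ => (F - p.2) / (ε - p.1)) '' {p ∈ D | p.1 < ε})
    (Set.insert_nonempty _ _) (Set.Nonempty.image _ hslater) <| by
      rintro _ (rfl | ⟨p, ⟨hp, h⟩, rfl⟩) _ ⟨p', ⟨hp', h'⟩, rfl⟩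
      · exact div_nonneg (sub_nonneg.2 (hF p' hp' h'.le)) (sub_nonneg.2 h'.le)
      · exact div_le_div_of_convex hD hF hp hp' h h'
  refine ⟨l, hlower (Set.mem_insert _ _), fun p hp => ?_⟩
  rcases lt_trichotomy p.1 ε with h | h | h
  · have := (le_div_iff₀ (sub_pos.2 h)).1 (hupper ⟨p, ⟨hp, h⟩, rfl⟩)
    linarith
  · simpa [h] using hF p hp h.le
  · have := (div_le_iff₀ (sub_pos.2 h)).1 (hlower (Set.mem_insert_of_mem _ ⟨p, ⟨hp, h⟩, rfl⟩))
    linarith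

theorem exists_forall_le_and_sum_le {α : Type*} [Nonempty α] {M : ℕ} {ψ : Fin M → α → ℝ} {B : ℝ}
    (h : ∀ v : Fin M → α, ∑ n, ψ n (v n) ≤ B) :
    ∃ t : Fin M → ℝ, (∀ n a, ψ n a ≤ t n) ∧ ∑ n, t n ≤ B := by
  induction M generalizing B with
  | zero => exact ⟨0, isEmptyElim, by simpa using h isEmptyElim⟩
  | succ M ih =>
    have hcons : ∀ a (v : Fin M → α), ψ 0 a ≤ B - ∑ n, ψ n.succ (v n) := fun a v => by
      simpa [Fin.sum_univ_succ, le_sub_iff_add_le] using h (Fin.cons a v)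
    have hbdd : BddAbove (Set.range (ψ 0)) :=
      ⟨_, Set.forall_mem_range.2 fun a => hcons a fun _ => Classical.arbitrary α⟩
    obtain ⟨t, ht, hsum⟩ := ih (B := B - ⨆ a, ψ 0 a) (ψ := fun n => ψ n.succ) fun v =>
      le_sub_comm.1 (ciSup_le fun a => hcons a v)
    refine ⟨Fin.cons (⨆ a, ψ 0 a) t, Fin.cases (le_ciSup hbdd) ht, ?_⟩
    simpa [Fin.sum_univ_succ, le_sub_iff_add_le'] using hsum

theorem exists_forall_le_and_dotProduct_le {α : Type*} {S : Set α} (hS : S.Nonempty) {M : ℕ}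
    {ω : Fin M → ℝ} (hω : ∀ n, 0 ≤ ω n) {φ : Fin M → α → ℝ} {B : ℝ}
    (h : ∀ v : Fin M → α, (∀ n, v n ∈ S) → ∑ n, ω n * φ n (v n) ≤ B) :
    ∃ t : Fin M → ℝ, (∀ n, 0 < ω n → ∀ a ∈ S, φ n a ≤ t n) ∧ ω ⬝ᵥ t ≤ B := by
  have := hS.to_subtype
  obtain ⟨t, ht, hsum⟩ := exists_forall_le_and_sum_le (α := S) (ψ := fun n a => ω n * φ n a)
    fun v => h (fun n => v n) fun n => (v n).2
  refine ⟨fun n => t n / ω n, fun n hn a ha => (le_div_iff₀' hn).2 (ht n ⟨a, ha⟩), ?_⟩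
  refine (Finset.sum_le_sum fun n _ => ?_).trans hsum
  rcases (hω n).eq_or_lt with hn | hn
  · obtain ⟨a, ha⟩ := hS
    simpa [← hn] using ht n ⟨a, ha⟩
  · exact (mul_div_cancel₀ _ hn.ne').le

end Multipliers

section WeightedDirac

variable {α I : Type*} [MeasurableSpace α] [MeasurableSingletonClass α] [Fintype I] {ω : I → ℝ}

theorem integrable_sum_smul_dirac (a : I → α) (f : α → ℝ) :
    Integrable f (∑ n, ENNReal.ofReal (ω n) • Measure.dirac (a n)) :=
  integrable_finsetSum_measure.2 fun _ _ =>
    (integrable_dirac (by simp)).smul_measure ENNReal.ofReal_ne_top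

theorem integral_sum_smul_dirac (hω : ∀ n, 0 ≤ ω n) (a : I → α) (f : α → ℝ) :
    ∫ v, f v ∂(∑ n, ENNReal.ofReal (ω n) • Measure.dirac (a n)) = ∑ n, ω n * f (a n) := by
  rw [integral_finsetSum_measure fun n _ =>
    (integrable_dirac (by simp)).smul_measure ENNReal.ofReal_ne_top]
  simp [integral_smul_measure, hω]

theorem ae_sum_smul_dirac {p : α → Prop} {a : I → α} (h : ∀ n, 0 < ω n → p (a n)) :
    ∀ᵐ v ∂(∑ n, ENNReal.ofReal (ω n) • Measure.dirac (a n)), p v := by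
  rw [← Measure.sum_fintype, Measure.ae_sum_iff]
  intro n
  rcases le_or_gt (ω n) 0 with hn | hn
  · simp [ENNReal.ofReal_of_nonpos hn]
  · exact Measure.ae_smul_measure (by simpa [ae_dirac_eq] using h n hn) _

end WeightedDirac

theorem continuous_seminorm_of_finiteDimensional {E : Type*} [NormedAddCommGroup E]
    [NormedSpace ℝ E] [FiniteDimensional ℝ E] (N : Seminorm ℝ E) : Continuous N :=
  continuousOn_univ.1 (N.convexOn.continuousOn isOpen_univ)

theorem continuousOn_of_le_add_mul {E : Type*} [NormedAddCommGroup E]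
    [NormedSpace ℝ E] [FiniteDimensional ℝ E] {N : Seminorm ℝ E} {S : Set E} {f : E → ℝ} {L : ℝ}
    (hL : ∀ u ∈ S, ∀ v ∈ S, f u ≤ f v + L * N (u - v)) : ContinuousOn f S := by
  intro v hv
  rw [ContinuousWithinAt, tendsto_iff_dist_tendsto_zero]
  have hcont : Continuous fun u => L * N (u - v) :=
    continuous_const.mul
      ((continuous_seminorm_of_finiteDimensional N).comp (continuous_sub_right v))
  have hlim : Filter.Tendsto (fun u => L * N (u - v)) (nhdsWithin v S) (nhds 0) := by
    simpa [ContinuousWithinAt] using hcont.continuousWithinAt (s := S) (x := v)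
  refine squeeze_zero' (Filter.Eventually.of_forall fun _ => dist_nonneg) ?_ hlim
  filter_upwards [self_mem_nhdsWithin] with u hu
  have := hL v hv u hu
  rw [map_sub_rev] at this
  exact abs_sub_le_iff.2 ⟨sub_le_iff_le_add'.2 (hL u hu v hv), sub_le_iff_le_add'.2 this⟩

section Couplings

variable {K : ℕ} {N : Seminorm ℝ (Fin K → ℝ)} {Ξ : Set (Fin K → ℝ)} {Pref : Measure (Fin K → ℝ)}
  {c : (Fin K → ℝ) → ℝ} {ε L : ℝ}

/-- `π` is a coupling of `Pref` with some distribution supported on `Ξ`, at finite expected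
transport cost. -/
structure IsFiniteCoupling (N : Seminorm ℝ (Fin K → ℝ)) (Ξ : Set (Fin K → ℝ))
    (Pref : Measure (Fin K → ℝ)) (π : Measure ((Fin K → ℝ) × (Fin K → ℝ))) : Prop where
  fst : π.fst = Pref
  ae_snd : ∀ᵐ p ∂π, p.2 ∈ Ξ
  integrable : Integrable (fun p => N (p.1 - p.2)) π

variable {π π' : Measure ((Fin K → ℝ) × (Fin K → ℝ))}

theorem IsFiniteCoupling.isProbabilityMeasure [IsProbabilityMeasure Pref]
    (h : IsFiniteCoupling N Ξ Pref π) : IsProbabilityMeasure π :=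
  ⟨by rw [← Measure.fst_univ, h.fst, measure_univ]⟩

theorem IsFiniteCoupling.aestronglyMeasurable (hΞ : MeasurableSet Ξ)
    (hL : ∀ u ∈ Ξ, ∀ v ∈ Ξ, c u ≤ c v + L * N (u - v)) (h : IsFiniteCoupling N Ξ Pref π) :
    AEStronglyMeasurable c π.snd := by
  have hmem : ∀ᵐ v ∂π.snd, v ∈ Ξ := (ae_map_iff measurable_snd.aemeasurable hΞ).2 h.ae_snd
  simpa only [Measure.restrict_eq_self_of_ae_mem hmem] using
    (continuousOn_of_le_add_mul hL).aestronglyMeasurable (μ := π.snd) hΞ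

theorem IsFiniteCoupling.smul_add_smul (h : IsFiniteCoupling N Ξ Pref π)
    (h' : IsFiniteCoupling N Ξ Pref π') {a b : ℝ} (ha : 0 ≤ a) (hb : 0 ≤ b) (hab : a + b = 1) :
    IsFiniteCoupling N Ξ Pref (ENNReal.ofReal a • π + ENNReal.ofReal b • π') where
  fst := by
    rw [Measure.fst_add, Measure.fst, Measure.fst, Measure.map_smul, Measure.map_smul]
    change _ • π.fst + _ • π'.fst = _
    rw [h.fst, h'.fst, ← add_smul, ← ENNReal.ofReal_add ha hb, hab, ENNReal.ofReal_one, one_smul]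
  ae_snd := ae_add_measure_iff.2
    ⟨Measure.ae_smul_measure h.ae_snd _, Measure.ae_smul_measure h'.ae_snd _⟩
  integrable := (h.integrable.smul_measure ENNReal.ofReal_ne_top).add_measure
    (h'.integrable.smul_measure ENNReal.ofReal_ne_top)

theorem integral_smul_add_smul_measure {α : Type*} [MeasurableSpace α] {μ ν : Measure α}
    {f : α → ℝ} (hμ : Integrable f μ) (hν : Integrable f ν) {a b : ℝ} (ha : 0 ≤ a) (hb : 0 ≤ b) :
    ∫ v, f v ∂(ENNReal.ofReal a • μ + ENNReal.ofReal b • ν) =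
      a * ∫ v, f v ∂μ + b * ∫ v, f v ∂ν := by
  rw [integral_add_measure (hμ.smul_measure ENNReal.ofReal_ne_top)
    (hν.smul_measure ENNReal.ofReal_ne_top)]
  simp [integral_smul_measure, ha, hb]

theorem exists_isFiniteCoupling_of_mem_wassersteinAmbiguitySet (hΞ : MeasurableSet Ξ)
    {P : Measure (Fin K → ℝ)} (hP : P ∈ wassersteinAmbiguitySet N Ξ Pref ε) (hε : 0 ≤ ε)
    {δ : ℝ} (hδ : 0 < δ) :
    ∃ π, IsFiniteCoupling N Ξ Pref π ∧ π.snd = P ∧ ∫ p, N (p.1 - p.2) ∂π ≤ ε + δ := by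
  obtain ⟨hprob, hPΞ, hW⟩ := hP
  have hlt : wassersteinDist N Pref P < ENNReal.ofReal (ε + δ) :=
    hW.trans_lt ((ENNReal.ofReal_lt_ofReal_iff (by positivity)).2 (lt_add_of_pos_right ε hδ))
  simp only [wassersteinDist, iInf_lt_iff] at hlt
  obtain ⟨π, ⟨hfst, rfl⟩, hlt⟩ := hlt
  have hmeas : Measurable fun p : (Fin K → ℝ) × (Fin K → ℝ) => N (p.1 - p.2) :=
    ((continuous_seminorm_of_finiteDimensional N).comp (by fun_prop)).measurable
  have hnonneg : ∀ᵐ p ∂π, 0 ≤ N (p.1 - p.2) := ae_of_all _ fun _ => apply_nonneg N _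
  refine ⟨π, ⟨hfst, ?_, hmeas.aestronglyMeasurable, ?_⟩, rfl, ?_⟩
  · have hsupp : ∀ᵐ v ∂π.snd, v ∈ Ξ := (prob_compl_eq_zero_iff hΞ).2 hPΞ
    exact ae_of_ae_map measurable_snd.aemeasurable hsupp
  · exact (hasFiniteIntegral_iff_ofReal hnonneg).2 (hlt.trans ENNReal.ofReal_lt_top)
  · rw [integral_eq_lintegral_of_nonneg_ae hnonneg hmeas.aestronglyMeasurable]
    exact ENNReal.toReal_le_of_le_ofReal (by positivity) hlt.le

theorem IsFiniteCoupling.snd_mem_wassersteinAmbiguitySet (hΞ : MeasurableSet Ξ)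
    [IsProbabilityMeasure Pref] (h : IsFiniteCoupling N Ξ Pref π)
    (hle : ∫ p, N (p.1 - p.2) ∂π ≤ ε) : π.snd ∈ wassersteinAmbiguitySet N Ξ Pref ε := by
  have := h.isProbabilityMeasure
  refine ⟨inferInstance, ?_, (iInf₂_le π ⟨h.fst, rfl⟩).trans ?_⟩
  · rw [Measure.snd_apply hΞ]
    exact (prob_compl_eq_zero_iff (measurable_snd hΞ)).1 h.ae_snd
  · rw [← ofReal_integral_eq_lintegral_ofReal h.integrable (ae_of_all _ fun _ => apply_nonneg N _)]
    exact ENNReal.ofReal_le_ofReal hle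

end Couplings

section WassersteinDuality

variable {K M : ℕ} {N : Seminorm ℝ (Fin K → ℝ)} {Ξ : Set (Fin K → ℝ)}
  {y : Fin M → Fin K → ℝ} {ω : Fin M → ℝ} {c : (Fin K → ℝ) → ℝ} {ε L l : ℝ} {t : Fin M → ℝ}

theorem isProbabilityMeasure_weightedEmpirical (hω : ω ∈ stdSimplex ℝ (Fin M)) :
    IsProbabilityMeasure (weightedEmpirical ω y) :=
  ⟨by simp [weightedEmpirical, ← ENNReal.ofReal_sum_of_nonneg fun n _ => hω.1 n, hω.2]⟩

theorem nonempty_of_mem_stdSimplex (hω : ω ∈ stdSimplex ℝ (Fin M)) (hy : ∀ n, y n ∈ Ξ) :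
    Ξ.Nonempty := by
  rcases isEmpty_or_nonempty (Fin M) with h | ⟨⟨n⟩⟩
  · simp [stdSimplex_of_isEmpty_index] at hω
  · exact ⟨_, hy n⟩

/-- `(l, t)` is feasible for the dual of the worst-case expectation problem, which minimizes
`l * ε + ω ⬝ᵥ t`: the multiplier `l` prices transport, and `t n` bounds the cost net of transport
that an atom `y n` of positive weight can achieve. -/
def IsDualFeasible (N : Seminorm ℝ (Fin K → ℝ)) (Ξ : Set (Fin K → ℝ)) (y : Fin M → Fin K → ℝ)
    (ω : Fin M → ℝ) (c : (Fin K → ℝ) → ℝ) (l : ℝ) (t : Fin M → ℝ) : Prop :=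
  0 ≤ l ∧ ∀ n, 0 < ω n → ∀ v ∈ Ξ, c v - l * N (v - y n) ≤ t n

theorem isDualFeasible_of_le_add_mul (hL0 : 0 ≤ L) (hy : ∀ n, y n ∈ Ξ)
    (hL : ∀ u ∈ Ξ, ∀ v ∈ Ξ, c u ≤ c v + L * N (u - v)) :
    IsDualFeasible N Ξ y ω c L fun n => c (y n) :=
  ⟨hL0, fun n _ v hv => sub_le_iff_le_add.2 (hL v hv _ (hy n))⟩

namespace IsFiniteCoupling

variable {π : Measure ((Fin K → ℝ) × (Fin K → ℝ))}

theorem ae_fst (h : IsFiniteCoupling N Ξ (weightedEmpirical ω y) π) :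
    ∀ᵐ p ∂π, ∃ n, 0 < ω n ∧ p.1 = y n := by
  refine ae_of_ae_map (p := fun v => ∃ n, 0 < ω n ∧ v = y n) measurable_fst.aemeasurable ?_
  change ∀ᵐ v ∂π.fst, _
  rw [h.fst]
  exact ae_sum_smul_dirac fun n hn => ⟨n, hn, rfl⟩

theorem integrable_comp_fst (h : IsFiniteCoupling N Ξ (weightedEmpirical ω y) π)
    (τ : (Fin K → ℝ) → ℝ) : Integrable (fun p => τ p.1) π := by
  refine Integrable.comp_measurable (g := τ) ?_ measurable_fst
  change Integrable τ π.fst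
  rw [h.fst]
  exact integrable_sum_smul_dirac y τ

theorem integral_comp_fst (h : IsFiniteCoupling N Ξ (weightedEmpirical ω y) π)
    (hω : ∀ n, 0 ≤ ω n) (τ : (Fin K → ℝ) → ℝ) : ∫ p, τ p.1 ∂π = ∑ n, ω n * τ (y n) := by
  rw [← integral_sum_smul_dirac hω, ← weightedEmpirical, ← h.fst]
  refine (integral_map measurable_fst.aemeasurable (Integrable.aestronglyMeasurable ?_)).symm
  change Integrable τ π.fst
  rw [h.fst]
  exact integrable_sum_smul_dirac y τ

theorem integrable_comp_snd (h : IsFiniteCoupling N Ξ (weightedEmpirical ω y) π)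
    (hΞ : MeasurableSet Ξ) (hy : ∀ n, y n ∈ Ξ)
    (hL : ∀ u ∈ Ξ, ∀ v ∈ Ξ, c u ≤ c v + L * N (u - v)) : Integrable (fun p => c p.2) π := by
  refine Integrable.mono' ((h.integrable_comp_fst fun u => |c u|).add (h.integrable.const_mul L))
    ((h.aestronglyMeasurable hΞ hL).comp_measurable measurable_snd) ?_
  filter_upwards [h.ae_fst, h.ae_snd] with p ⟨n, _, hn⟩ hp
  have hupper := hL _ hp _ (hy n)
  have hlower := hL _ (hy n) _ hp
  rw [map_sub_rev] at hupper
  simp only [Pi.add_apply, Real.norm_eq_abs, hn]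
  exact abs_le.2 ⟨by linarith [neg_abs_le (c (y n))], by linarith [le_abs_self (c (y n))]⟩

theorem integral_snd (h : IsFiniteCoupling N Ξ (weightedEmpirical ω y) π) (hΞ : MeasurableSet Ξ)
    (hL : ∀ u ∈ Ξ, ∀ v ∈ Ξ, c u ≤ c v + L * N (u - v)) :
    ∫ v, c v ∂π.snd = ∫ p, c p.2 ∂π :=
  integral_map measurable_snd.aemeasurable (h.aestronglyMeasurable hΞ hL)

theorem integral_comp_snd_le (h : IsFiniteCoupling N Ξ (weightedEmpirical ω y) π)
    (hω : ∀ n, 0 ≤ ω n) (hc : Integrable (fun p => c p.2) π) (hlt : IsDualFeasible N Ξ y ω c l t) :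
    ∫ p, c p.2 ∂π ≤ l * ∫ p, N (p.1 - p.2) ∂π + ω ⬝ᵥ t := by
  -- Several indices may share an atom `u`; the best of their bounds is a function of `u` alone.
  let τ : (Fin K → ℝ) → ℝ := fun u => ⨅ n : {n // 0 < ω n ∧ u = y n}, t n
  have hτ : ∑ n, ω n * τ (y n) ≤ ω ⬝ᵥ t := Finset.sum_le_sum fun n _ => by
    rcases (hω n).eq_or_lt with hn | hn
    · simp [← hn]
    · exact mul_le_mul_of_nonneg_left (ciInf_le (Set.finite_range
        fun m : {m // 0 < ω m ∧ y n = y m} => t m).bddBelow ⟨n, hn, rfl⟩) hn.le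
  have hle : ∀ᵐ p ∂π, c p.2 ≤ l * N (p.1 - p.2) + τ p.1 := by
    filter_upwards [h.ae_fst, h.ae_snd] with p ⟨n, hn, hpn⟩ hp
    have : Nonempty {n // 0 < ω n ∧ p.1 = y n} := ⟨⟨n, hn, hpn⟩⟩
    refine sub_le_iff_le_add'.1 (le_ciInf fun m => ?_)
    have := hlt.2 m m.2.1 _ hp
    rwa [← m.2.2, map_sub_rev] at this
  calc ∫ p, c p.2 ∂π ≤ ∫ p, (l * N (p.1 - p.2) + τ p.1) ∂π :=
        integral_mono_ae hc ((h.integrable.const_mul l).add (h.integrable_comp_fst τ)) hle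
    _ = l * ∫ p, N (p.1 - p.2) ∂π + ∑ n, ω n * τ (y n) := by
        rw [integral_add (h.integrable.const_mul l) (h.integrable_comp_fst τ),
          integral_const_mul, h.integral_comp_fst hω]
    _ ≤ _ := add_le_add_right hτ _

end IsFiniteCoupling

theorem integrable_of_mem_wassersteinAmbiguitySet (hΞ : MeasurableSet Ξ) (hy : ∀ n, y n ∈ Ξ)
    (hε : 0 ≤ ε) (hL : ∀ u ∈ Ξ, ∀ v ∈ Ξ, c u ≤ c v + L * N (u - v)) {P : Measure (Fin K → ℝ)}
    (hP : P ∈ wassersteinAmbiguitySet N Ξ (weightedEmpirical ω y) ε) : Integrable c P := by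
  obtain ⟨π, hπ, rfl, -⟩ :=
    exists_isFiniteCoupling_of_mem_wassersteinAmbiguitySet hΞ hP hε one_pos
  exact (integrable_map_measure (hπ.aestronglyMeasurable hΞ hL) measurable_snd.aemeasurable).2
    (hπ.integrable_comp_snd hΞ hy hL)

theorem integral_le_of_isDualFeasible (hΞ : MeasurableSet Ξ) (hy : ∀ n, y n ∈ Ξ)
    (hω : ∀ n, 0 ≤ ω n) (hε : 0 ≤ ε) (hL : ∀ u ∈ Ξ, ∀ v ∈ Ξ, c u ≤ c v + L * N (u - v))
    {P : Measure (Fin K → ℝ)} (hP : P ∈ wassersteinAmbiguitySet N Ξ (weightedEmpirical ω y) ε)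
    (hlt : IsDualFeasible N Ξ y ω c l t) : ∫ v, c v ∂P ≤ l * ε + ω ⬝ᵥ t := by
  refine sub_nonneg.1 (nonneg_of_forall_pos_add_mul (b := l) fun δ hδ => ?_)
  obtain ⟨π, hπ, rfl, hcost⟩ :=
    exists_isFiniteCoupling_of_mem_wassersteinAmbiguitySet hΞ hP hε hδ
  rw [hπ.integral_snd hΞ hL]
  have := hπ.integral_comp_snd_le hω (hπ.integrable_comp_snd hΞ hy hL) hlt
  linarith [mul_le_mul_of_nonneg_left hcost hlt.1]

/-- The pairs of expected transport cost and expected cost that couplings of `Pref` achieve. -/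
def couplingValues (N : Seminorm ℝ (Fin K → ℝ)) (Ξ : Set (Fin K → ℝ))
    (Pref : Measure (Fin K → ℝ)) (c : (Fin K → ℝ) → ℝ) : Set (ℝ × ℝ) :=
  (fun π => (∫ p, N (p.1 - p.2) ∂π, ∫ p, c p.2 ∂π)) '' {π | IsFiniteCoupling N Ξ Pref π}

theorem convex_couplingValues (hΞ : MeasurableSet Ξ) (hy : ∀ n, y n ∈ Ξ)
    (hL : ∀ u ∈ Ξ, ∀ v ∈ Ξ, c u ≤ c v + L * N (u - v)) :
    Convex ℝ (couplingValues N Ξ (weightedEmpirical ω y) c) := by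
  rintro _ ⟨π, hπ, rfl⟩ _ ⟨π', hπ', rfl⟩ a b ha hb hab
  refine ⟨_, hπ.smul_add_smul hπ' ha hb hab, Prod.ext ?_ ?_⟩
  · exact integral_smul_add_smul_measure hπ.integrable hπ'.integrable ha hb
  · exact integral_smul_add_smul_measure (hπ.integrable_comp_snd hΞ hy hL)
      (hπ'.integrable_comp_snd hΞ hy hL) ha hb

theorem mem_couplingValues_of_selection (hω : ∀ n, 0 ≤ ω n) {v : Fin M → Fin K → ℝ}
    (hv : ∀ n, v n ∈ Ξ) :
    (∑ n, ω n * N (y n - v n), ∑ n, ω n * c (v n)) ∈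
      couplingValues N Ξ (weightedEmpirical ω y) c := by
  refine ⟨∑ n, ENNReal.ofReal (ω n) • Measure.dirac (y n, v n), ⟨?_, ?_, ?_⟩, Prod.ext ?_ ?_⟩
  · ext s hs
    simp only [Measure.fst_apply hs, weightedEmpirical, Measure.coe_finsetSum, Finset.sum_apply,
      Measure.smul_apply, Measure.dirac_apply' _ hs, Measure.dirac_apply' _ (measurable_fst hs)]
    rfl
  · exact ae_sum_smul_dirac fun n _ => hv n
  · exact integrable_sum_smul_dirac _ _
  · exact integral_sum_smul_dirac hω _ fun p : (Fin K → ℝ) × (Fin K → ℝ) => N (p.1 - p.2)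
  · exact integral_sum_smul_dirac hω _ fun p : (Fin K → ℝ) × (Fin K → ℝ) => c p.2

theorem exists_multiplier_couplingValues (hΞ : MeasurableSet Ξ) (hy : ∀ n, y n ∈ Ξ)
    (hω : ∀ n, 0 ≤ ω n) (hε : 0 ≤ ε) (hL0 : 0 ≤ L)
    (hL : ∀ u ∈ Ξ, ∀ v ∈ Ξ, c u ≤ c v + L * N (u - v)) {F : ℝ}
    (hF : ∀ q ∈ couplingValues N Ξ (weightedEmpirical ω y) c, q.1 ≤ ε → q.2 ≤ F) :
    ∃ l, 0 ≤ l ∧ ∀ q ∈ couplingValues N Ξ (weightedEmpirical ω y) c, q.2 + l * (ε - q.1) ≤ F := by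
  have hzero : (0, ω ⬝ᵥ fun n => c (y n)) ∈ couplingValues N Ξ (weightedEmpirical ω y) c := by
    simpa [dotProduct] using mem_couplingValues_of_selection (N := N) (c := c) (y := y) hω hy
  rcases hε.eq_or_lt with rfl | hε
  · refine ⟨L, hL0, ?_⟩
    rintro _ ⟨π, hπ, rfl⟩
    have := hπ.integral_comp_snd_le hω (hπ.integrable_comp_snd hΞ hy hL)
      (isDualFeasible_of_le_add_mul hL0 hy hL)
    linarith [hF _ hzero le_rfl]
  · exact exists_multiplier_of_convex (convex_couplingValues hΞ hy hL) ⟨_, hzero, hε⟩ hF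

theorem exists_isDualFeasible_le (hω : ω ∈ stdSimplex ℝ (Fin M)) (hΞ : Ξ.Nonempty) {F : ℝ}
    (hl : 0 ≤ l)
    (hF : ∀ q ∈ couplingValues N Ξ (weightedEmpirical ω y) c, q.2 + l * (ε - q.1) ≤ F) :
    ∃ t, IsDualFeasible N Ξ y ω c l t ∧ l * ε + ω ⬝ᵥ t ≤ F := by
  obtain ⟨t, ht, hsum⟩ := exists_forall_le_and_dotProduct_le hΞ hω.1 (B := F - l * ε)
    (φ := fun n v => c v - l * N (v - y n)) fun v hv => by
      have := hF _ (mem_couplingValues_of_selection hω.1 hv)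
      simp only [mul_sub, Finset.sum_sub_distrib, mul_left_comm (ω _), ← Finset.mul_sum,
        map_sub_rev N _ (y _)] at this ⊢
      linarith
  exact ⟨t, ⟨hl, ht⟩, by linarith⟩

theorem exists_iSup_integral_eq_isLeast (hΞ : MeasurableSet Ξ) (hy : ∀ n, y n ∈ Ξ)
    (hω : ω ∈ stdSimplex ℝ (Fin M)) (hε : 0 ≤ ε) (hL0 : 0 ≤ L)
    (hL : ∀ u ∈ Ξ, ∀ v ∈ Ξ, c u ≤ c v + L * N (u - v)) :
    ∃ F : ℝ, (⨆ P ∈ wassersteinAmbiguitySet N Ξ (weightedEmpirical ω y) ε,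
        ((∫ v, c v ∂P : ℝ) : EReal)) = F ∧
      IsLeast {τ | ∃ l t, IsDualFeasible N Ξ y ω c l t ∧ l * ε + ω ⬝ᵥ t ≤ τ} F := by
  have := isProbabilityMeasure_weightedEmpirical (y := y) hω
  set 𝒰 := wassersteinAmbiguitySet N Ξ (weightedEmpirical ω y) ε
  set s := ⨆ P ∈ 𝒰, ((∫ v, c v ∂P : ℝ) : EReal)
  have hweak : ∀ l t, IsDualFeasible N Ξ y ω c l t → s ≤ ((l * ε + ω ⬝ᵥ t : ℝ) : EReal) :=
    fun l t hlt => iSup₂_le fun P hP =>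
      EReal.coe_le_coe (integral_le_of_isDualFeasible hΞ hy hω.1 hε hL hP hlt)
  have hprimal : ∀ q ∈ couplingValues N Ξ (weightedEmpirical ω y) c,
      q.1 ≤ ε → (q.2 : EReal) ≤ s := by
    rintro _ ⟨π, hπ, rfl⟩ hq
    change ((∫ p, c p.2 ∂π : ℝ) : EReal) ≤ s
    rw [← hπ.integral_snd hΞ hL]
    exact le_iSup₂ (f := fun P (_ : P ∈ 𝒰) => ((∫ v, c v ∂P : ℝ) : EReal)) π.snd
      (hπ.snd_mem_wassersteinAmbiguitySet hΞ hq)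
  have hzero := mem_couplingValues_of_selection (N := N) (c := c) (y := y) hω.1 hy
  have htop : s ≠ ⊤ := ((hweak L _ (isDualFeasible_of_le_add_mul hL0 hy hL)).trans_lt
    (EReal.coe_lt_top _)).ne
  have hbot : s ≠ ⊥ := ((EReal.bot_lt_coe _).trans_le (hprimal _ hzero (by simpa))).ne'
  obtain ⟨F, hF⟩ : ∃ F : ℝ, s = F := ⟨_, (EReal.coe_toReal htop hbot).symm⟩
  rw [hF] at hweak hprimal
  obtain ⟨l, hl, hmul⟩ := exists_multiplier_couplingValues hΞ hy hω.1 hε hL0 hL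
    fun q hq hqε => EReal.coe_le_coe_iff.1 (hprimal q hq hqε)
  obtain ⟨t, ht, hle⟩ := exists_isDualFeasible_le hω (nonempty_of_mem_stdSimplex hω hy) hl hmul
  exact ⟨F, hF, ⟨l, t, ht, hle⟩, fun τ ⟨l, t, hlt, hτ⟩ =>
    (EReal.coe_le_coe_iff.1 (hweak l t hlt)).trans hτ⟩

end WassersteinDuality

section Reformulation

variable {𝒦 : ∀ m : ℕ, Set (Fin m → ℝ) → Prop} {ι : Type} {K M : ℕ}
  {N : Seminorm ℝ (Fin K → ℝ)} {X : Set (ι → ℝ)} {Ξ : Set (Fin K → ℝ)}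
  {c : (ι → ℝ) → (Fin K → ℝ) → ℝ}

theorem isDualFeasible_of_forall_of_exists_le (hne : Ξ.Nonempty) {y : Fin M → Fin K → ℝ}
    {ω t : Fin M → ℝ} {l : ℝ} {f : (Fin K → ℝ) → ℝ} {I : Type*} {φ : I → (Fin K → ℝ) → ℝ}
    (h : ∀ i, IsDualFeasible N Ξ y ω (φ i) l t) (hf : ∀ v ∈ Ξ, ∃ i, f v ≤ φ i v) :
    IsDualFeasible N Ξ y ω f l t := by
  constructor
  · obtain ⟨v, hv⟩ := hne
    obtain ⟨i, -⟩ := hf v hv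
    exact (h i).1
  · intro n hn v hv
    obtain ⟨i, hi⟩ := hf v hv
    exact (sub_le_sub_right hi _).trans ((h i).2 n hn v hv)

theorem isConeRepresentable_isDualFeasible (hSOC : ∀ m, 𝒦 (m + 1) (secondOrderCone m))
    (hN : ∀ y, N y = 0 → y = 0) (hdual : 𝒦 (K + 1) (dualNormCone N)) (hΞ : IsSOCRepresentable Ξ)
    (hne : Ξ.Nonempty) (y : Fin M → Fin K → ℝ) (ω : Fin M → ℝ) :
    IsConeRepresentable 𝒦 {p : ((Fin K → ℝ) × ℝ) × ℝ × (Fin M → ℝ) |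
      IsDualFeasible N Ξ y ω (fun v => p.1.1 ⬝ᵥ v + p.1.2) p.2.1 p.2.2} := by
  have hatom := IsConeRepresentable.forall_mem fun n : {n // 0 < ω n} =>
    (isConeRepresentable_forall_dotProduct_sub_le hN hSOC hdual hΞ hne (y n)).comap
      (ψ := fun p : ((Fin K → ℝ) × ℝ) × ℝ × (Fin M → ℝ) => (p.1.1, p.2.1, p.2.2 n - p.1.2))
      (by fun_prop)
  have hl : IsConeRepresentable 𝒦 {p : ((Fin K → ℝ) × ℝ) × ℝ × (Fin M → ℝ) | 0 ≤ p.2.1} :=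
    .nonneg hSOC (by fun_prop)
  convert hl.and hatom using 3 with p
  refine and_congr_right fun hp => ?_
  simp only [Subtype.forall, Set.mem_ofPred_eq, hp, true_and, le_sub_iff_add_le, sub_add_eq_add_sub]

theorem IsMaxAffineCost.exists_isConeRepresentable_isDualFeasible
    (hSOC : ∀ m, 𝒦 (m + 1) (secondOrderCone m)) (hN : ∀ y, N y = 0 → y = 0)
    (hdual : 𝒦 (K + 1) (dualNormCone N)) (hΞ : IsSOCRepresentable Ξ) (hne : Ξ.Nonempty)
    (hc : IsMaxAffineCost 𝒦 X Ξ c) (y : Fin M → Fin K → ℝ) (ω : Fin M → ℝ) (ε : ℝ) :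
    ∃ G : Set ((ι → ℝ) × ℝ), IsConeRepresentable 𝒦 G ∧ ∀ x ∈ X, ∀ τ,
      (x, τ) ∈ G ↔ ∃ l t, IsDualFeasible N Ξ y ω (c x) l t ∧ l * ε + ω ⬝ᵥ t ≤ τ := by
  obtain ⟨I, _, R, hR, hex, hmaj⟩ := hc
  let E := ((ι → ℝ) × ℝ) × (I → (Fin K → ℝ) × ℝ) × ℝ × (Fin M → ℝ)
  have hfeas : IsConeRepresentable 𝒦 {p : E | ∀ i,
      IsDualFeasible N Ξ y ω (fun v => (p.2.1 i).1 ⬝ᵥ v + (p.2.1 i).2) p.2.2.1 p.2.2.2} :=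
    .forall_mem fun i => (isConeRepresentable_isDualFeasible hSOC hN hdual hΞ hne y ω).comap
      (ψ := fun p : E => (p.2.1 i, p.2.2)) (by fun_prop)
  have hbound : IsConeRepresentable 𝒦 {p : E | p.2.2.1 * ε + ω ⬝ᵥ p.2.2.2 ≤ p.1.2} :=
    .le hSOC (by fun_prop) (by fun_prop)
  refine ⟨_, ((hR.comap (ψ := fun p : E => (p.1.1, p.2.1)) (by fun_prop)).and
    (hfeas.and hbound)).proj, fun x hx τ => ⟨?_, ?_⟩⟩
  · rintro ⟨⟨d, l, t⟩, hd, hlt, hle⟩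
    exact ⟨l, t, isDualFeasible_of_forall_of_exists_le hne hlt (hmaj x hx d hd), hle⟩
  · rintro ⟨l, t, ⟨hl, ht⟩, hle⟩
    obtain ⟨d, hd, hmax⟩ := hex x hx
    refine ⟨(d, l, t), hd, fun i => ⟨hl, fun n hn v hv => ?_⟩, hle⟩
    exact (sub_le_sub_right ((hmax v hv).2 ⟨i, rfl⟩) _).trans (ht n hn v hv)

theorem IsMaxAffineCost.exists_le_add_mul (hN : ∀ y, N y = 0 → y = 0)
    (hc : IsMaxAffineCost 𝒦 X Ξ c) {x : ι → ℝ} (hx : x ∈ X) :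
    ∃ L : ℝ, 0 ≤ L ∧ ∀ u ∈ Ξ, ∀ v ∈ Ξ, c x u ≤ c x v + L * N (u - v) := by
  obtain ⟨I, _, R, -, hex, -⟩ := hc
  obtain ⟨d, -, hd⟩ := hex x hx
  exact exists_le_add_mul_of_isGreatest_range hN d hd

end Reformulation

theorem mainTheorem5 {n₁ n₂ K M : ℕ} {Z Θ : Type*}
    (N : Seminorm ℝ (Fin K → ℝ)) (hN : ∀ y : Fin K → ℝ, N y = 0 → y = 0)
    (Xbar : Set (Fin n₁ ⊕ Fin n₂ → ℝ)) (hXbar : IsSOCRepresentable Xbar)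
    (Ξ : Set (Fin K → ℝ)) (hΞ : IsSOCRepresentable Ξ)
    (c : (Fin n₁ ⊕ Fin n₂ → ℝ) → (Fin K → ℝ) → ℝ)
    (hc : IsSingleStageCost (mixedBinaryRegion Xbar) Ξ c ∨
      IsTwoStageCost (mixedBinaryRegion Xbar) Ξ c)
    (y : Fin M → Fin K → ℝ) (hy : ∀ n, y n ∈ Ξ)
    (ω : Z → Fin M → ℝ) (hω_nonneg : ∀ z n, 0 ≤ ω z n) (hω_sum : ∀ z, ∑ n, ω z n = 1)
    (ε : Θ → Z → ℝ) (hε : ∀ θ z, 0 ≤ ε θ z) (θ : Θ) (z : Z) :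
    (∀ x ∈ mixedBinaryRegion Xbar,
      ∀ P ∈ wassersteinAmbiguitySet N Ξ (weightedEmpirical (ω z) y) (ε θ z),
        MeasureTheory.Integrable (c x) P) ∧
    IsMixedIntegerLinearConeProgram (IsWassersteinCone N) (mixedBinaryRegion Xbar)
      (worstCaseExpectation
        (wassersteinAmbiguitySet N Ξ (weightedEmpirical (ω z) y) (ε θ z)) c) ∧
    ∀ xd : Fin n₁ → ℝ, (∀ i, xd i = 0 ∨ xd i = 1) →
      IsLinearConeProgram (IsWassersteinCone N)
        {xc : Fin n₂ → ℝ | Sum.elim xd xc ∈ mixedBinaryRegion Xbar}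
        (fun xc => worstCaseExpectation
          (wassersteinAmbiguitySet N Ξ (weightedEmpirical (ω z) y) (ε θ z)) c (Sum.elim xd xc)) := by
  have hSOC : ∀ m, IsWassersteinCone N (m + 1) (secondOrderCone m) := .secondOrder
  have hω : ω z ∈ stdSimplex ℝ (Fin M) := ⟨hω_nonneg z, hω_sum z⟩
  have hcost : IsMaxAffineCost (IsWassersteinCone N) (mixedBinaryRegion Xbar) Ξ c :=
    hc.elim (·.isMaxAffineCost hSOC) (·.isMaxAffineCost hSOC)
  obtain ⟨G, hG, hGdual⟩ := hcost.exists_isConeRepresentable_isDualFeasible hSOC hN .dualNorm hΞ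
    (nonempty_of_mem_stdSimplex hω hy) y (ω z) (ε θ z)
  have hGX : IsConeRepresentable (IsWassersteinCone N) {q | q.1 ∈ Xbar ∧ q ∈ G} :=
    ((IsConeRepresentable.of_isSOCRepresentable hSOC hXbar).comap (by fun_prop)).and hG
  have hleast : ∀ x ∈ mixedBinaryRegion Xbar, ∃ F : ℝ, worstCaseExpectation
      (wassersteinAmbiguitySet N Ξ (weightedEmpirical (ω z) y) (ε θ z)) c x = F ∧
      IsLeast {τ | x ∈ Xbar ∧ (x, τ) ∈ G} F := by
    intro x hx
    obtain ⟨L, hL0, hL⟩ := hcost.exists_le_add_mul hN hx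
    simpa only [hx.1, true_and, hGdual x hx, worstCaseExpectation] using
      exists_iSup_integral_eq_isLeast hΞ.measurableSet hy hω (hε θ z) hL0 hL
  refine ⟨fun x hx P hP => ?_, hGX.isMixedIntegerLinearConeProgram (fun x τ h => h.1) hleast,
    fun xd hxd => ?_⟩
  · obtain ⟨L, -, hL⟩ := hcost.exists_le_add_mul hN hx
    exact integrable_of_mem_wassersteinAmbiguitySet hΞ.measurableSet hy (hε θ z) hL hP
  · exact (hGX.comap (ψ := fun p : (Fin n₂ → ℝ) × ℝ => (Sum.elim xd p.1, p.2))
      (by fun_prop)).isLinearConeProgram (fun xc τ h => ⟨h.1, hxd⟩) fun xc hxc => hleast _ hxc
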